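/- **Setting.** Let $\mathfrak K$ be a separable complex Hilbert space, $\mathfrak H=\mathfrak K\otimes L^2(0,\infty)=L^2((0,\infty);\mathfrak K)$, and let $\mathfrak B(\cdot)_*$ denote the predual of $\mathfrak B(\cdot)$ (the normal linear functionals, with the dual norm). Let $\Lambda:\mathfrak B(\mathfrak K)\to\mathfrak B(\mathfrak H)$ be $(\Lambda(A)f)(x)=e^{-x}Af(x)$, with predual map $\hat\Lambda:\mathfrak B(\mathfrak H)_*\to\mathfrak B(\mathfrak K)_*$, let $E(t,\infty)$ be the projection of $\mathfrak H$ onto the functions supported in $(t,\infty)$, and put $A|_t=E(t,\infty)AE(t,\infty)$. Let $D=(I-\Lambda(I))^{1/2}$ and $\mathfrak A(\mathfrak H)=D\,\mathfrak B(\mathfrak H)\,D$. A *boundary weight* $\mu\in\mathfrak A(\mathfrak H)_*$ is a linear functional on $\mathfrak A(\mathfrak H)$ such that $A\mapsto\mu(DAD)$ is a bounded normal functional on $\mathfrak B(\mathfrak H)$; it is *positive* if it is nonnegative on positive elements of $\mathfrak A(\mathfrak H)$. A *boundary weight map* is a linear map $\omega:\mathfrak B(\mathfrak K)_*\to\mathfrak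 A(\mathfrak H)_*$, and its truncations $\omega|_t:\mathfrak B(\mathfrak K)_*\to\mathfrak B(\mathfrak H)_*$, $t>0$, are $\omega|_t(\rho)(A)=\omega(\rho)(A|_t)$. The map $\omega$ is a *$q$-weight map* if it is completely positive, $\omega(\rho)(I-\Lambda(I))\le\rho(I)$ for all positive $\rho$, and for every $t>0$ the map $I+\hat\Lambda\omega|_t$ on $\mathfrak B(\mathfrak K)_*$ is invertible and $\hat\pi_t=\omega|_t(I+\hat\Lambda\omega|_t)^{-1}$ is a completely positive contraction. If $\eta,\omega$ are $q$-weight maps with associated families $\hat\xi_t,\hat\pi_t$, then $\eta$ is a *$q$-subordinate* of $\omega$, written $\eta\le_q\omega$, if $\hat\pi_t-\hat\xi_t$ is completely positive for all $t>0$. A $q$-weight map is *$q$-pure* if the set of its $q$-subordinates is totally ordered by $\le_q$. The *range rank* of $\omega$ is the dimension of the range of the dualized map $\breve\omega:\mathfrak A(\mathfrak H)\to\mathfrak B(\mathfrak K)$ determined by $\rho(\breve\omega(A))=\omega(\rho)(A)$. **Theorem.** Let $e_1,e_2\in\mathfrak B(\mathfrak K)$ be positive operators such that, for real $x_1,x_2$,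 one has $0\le x_1e_1+x_2e_2\le I$ if and only if $x_1,x_2\in[0,1]$. Let $\mu_1,\mu_2$ be positive boundary weights such that $$\omega(\rho)=\rho(e_1)\,\mu_1+\rho(e_2)\,\mu_2\qquad(\rho\in\mathfrak B(\mathfrak K)_*)$$ is a $q$-weight map, and put $$\kappa_1=\sup_{t>0}\frac{\mu_1(\Lambda(e_2)|_t)}{1+\mu_2(\Lambda(e_2)|_t)},\qquad \kappa_2=\sup_{t>0}\frac{\mu_2(\Lambda(e_1)|_t)}{1+\mu_1(\Lambda(e_1)|_t)},$$ $$\eta(\rho)=\rho(e_1)(\mu_1-\kappa_1\mu_2),\qquad \nu(\rho)=\rho(e_2)(\mu_2-\kappa_2\mu_1).$$ 1. If $\mu_1\neq0$, $\mu_2\ne0$ and $\omega$ is $q$-pure, then $\mu_1=\mu_2$, and $\omega$ has range rank one. 2. The suprema $\kappa_1,\kappa_2$ are finite, and $\eta$ and $\nu$ are $q$-weight maps which are $q$-subordinates of $\omega$. 3. If $\eta\ne0$ and $\nu\neq0$, then $\eta$ and $\nu$ are incomparable: neither $\eta\le_q\nu$ nor $\nu\le_q\eta$. In particular this holds whenever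 $\omega$ has range rank two. -/

import Mathlib

open scoped ComplexOrder

namespace QWeight

noncomputable section

open MeasureTheory Set

/-! ### The Hilbert space `K ⊗ L²(0, ∞)` and multiplication operators -/

/-- Lebesgue measure on the half line `(0, ∞)`. -/
abbrev halfLine : Measure ℝ := volume.restrict (Ioi (0 : ℝ))

/-- `K ⊗ L²(0, ∞)`, realised as the space of square integrable `K`-valued functions. -/
abbrev HalfL2 (K : Type*) [NormedAddCommGroup K] : Type _ := Lp K 2 halfLine

/-- The bounded operators on a Hilbert space. -/
abbrev Op (K : Type*) [NormedAddCommGroup K] [InnerProductSpace ℂ K] : Type _ := K →L[ℂ] K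

section Defs

set_option linter.unusedSectionVars false

variable (K : Type*) [NormedAddCommGroup K] [InnerProductSpace ℂ K] [CompleteSpace K]

/-- The operator `(M f)(x) = φ x • f x` of multiplication by a bounded measurable real function. -/
def mulOp (φ : ℝ → ℝ) (hφ : MemLp (fun x => (φ x : ℂ)) ⊤ halfLine) : Op (HalfL2 K) :=
  (ContinuousLinearMap.lsmul ℂ ℂ).holderL halfLine ⊤ 2 2 hφ.toLp

variable {K} in
theorem mulOp_coeFn (φ : ℝ → ℝ) (hφ : MemLp (fun x => (φ x : ℂ)) ⊤ halfLine) (f : HalfL2 K) :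
    mulOp K φ hφ f =ᵐ[halfLine] fun x => (φ x : ℂ) • f x := by
  have h := (ContinuousLinearMap.lsmul ℂ ℂ (E := K)).coeFn_holder (r := 2) hφ.toLp f
  have h2 : mulOp K φ hφ f = (ContinuousLinearMap.lsmul ℂ ℂ (E := K)).holder 2 hφ.toLp f := rfl
  rw [h2]
  filter_upwards [h, hφ.coeFn_toLp] with x hx hx2
  rw [hx, hx2]
  rfl

theorem mulOp_mul (φ ψ χ : ℝ → ℝ) (hφ : MemLp (fun x => (φ x : ℂ)) ⊤ halfLine)
    (hψ : MemLp (fun x => (ψ x : ℂ)) ⊤ halfLine) (hχ : MemLp (fun x => (χ x : ℂ)) ⊤ halfLine)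
    (h : ∀ x, 0 < x → φ x * ψ x = χ x) : mulOp K φ hφ * mulOp K ψ hψ = mulOp K χ hχ := by
  ext1 f
  apply Lp.ext
  have hpos : ∀ᵐ x ∂halfLine, x ∈ Ioi (0 : ℝ) := ae_restrict_mem measurableSet_Ioi
  filter_upwards [mulOp_coeFn φ hφ (mulOp K ψ hψ f), mulOp_coeFn ψ hψ f, mulOp_coeFn χ hχ f,
    hpos] with x h1 h2 h3 h4
  have e1 : (mulOp K φ hφ * mulOp K ψ hψ) f = mulOp K φ hφ (mulOp K ψ hψ f) := rfl
  rw [e1, h1, h2, h3, smul_smul, ← h x h4]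
  push_cast
  rfl

theorem memLp_top_of_real (φ : ℝ → ℝ) (hm : Measurable φ) (C : ℝ)
    (h : ∀ x, 0 < x → |φ x| ≤ C) : MemLp (fun x => (φ x : ℂ)) ⊤ halfLine := by
  refine memLp_top_of_bound (Complex.measurable_ofReal.comp hm).aestronglyMeasurable C ?_
  filter_upwards [ae_restrict_mem measurableSet_Ioi] with x hx
  simpa using h x hx

theorem memLp_exp : MemLp (fun x => ((Real.exp (-x) : ℝ) : ℂ)) ⊤ halfLine := by
  refine memLp_top_of_real _ (by fun_prop) 1 fun x hx => ?_
  rw [abs_of_pos (Real.exp_pos _)]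
  exact Real.exp_le_one_iff.2 (by linarith)

theorem memLp_sqrt : MemLp (fun x => ((√(1 - Real.exp (-x)) : ℝ) : ℂ)) ⊤ halfLine := by
  refine memLp_top_of_real _ (by fun_prop) 1 fun x _ => ?_
  rw [abs_of_nonneg (Real.sqrt_nonneg _)]
  exact Real.sqrt_le_one.2 (by linarith [Real.exp_pos (-x)])

theorem memLp_indicator (t : ℝ) :
    MemLp (fun x => ((indicator (Ioi t) (fun _ => (1 : ℝ)) x : ℝ) : ℂ)) ⊤ halfLine := by
  refine memLp_top_of_real _ (measurable_const.indicator measurableSet_Ioi) 1 fun x _ => ?_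
  by_cases hx : x ∈ Ioi t <;> simp [hx]

theorem memLp_cutInv (t : Ioi (0 : ℝ)) :
    MemLp (fun x => ((indicator (Ioi (t : ℝ)) (fun y => (√(1 - Real.exp (-y)))⁻¹) x : ℝ) : ℂ))
      ⊤ halfLine := by
  refine memLp_top_of_real _ (Measurable.indicator (by fun_prop) measurableSet_Ioi)
    (√(1 - Real.exp (-(t : ℝ))))⁻¹ fun x _ => ?_
  have ht : (0 : ℝ) < t := t.2
  have h1 : 0 < 1 - Real.exp (-(t : ℝ)) := by
    have : Real.exp (-(t : ℝ)) < 1 := Real.exp_lt_one_iff.2 (by linarith)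
    linarith
  by_cases hx : x ∈ Ioi (t : ℝ)
  · rw [indicator_of_mem hx, abs_of_nonneg (inv_nonneg.2 (Real.sqrt_nonneg _))]
    apply inv_anti₀ (Real.sqrt_pos.2 h1)
    apply Real.sqrt_le_sqrt
    have : Real.exp (-x) ≤ Real.exp (-(t : ℝ)) := Real.exp_le_exp.2 (by linarith [mem_Ioi.1 hx])
    linarith
  · rw [indicator_of_notMem hx]
    simp

/-- `E(t, ∞)`, the projection onto the functions supported in `(t, ∞)`. -/
def cutE (t : ℝ) : Op (HalfL2 K) := mulOp K (indicator (Ioi t) fun _ => 1) (memLp_indicator t)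

/-- `(I - Λ(I))^{1/2}`, the operator of multiplication by `(1 - e^{-x})^{1/2}`. -/
def rootD : Op (HalfL2 K) := mulOp K (fun x => √(1 - Real.exp (-x))) memLp_sqrt

/-- Multiplication by `(1 - e^{-x})^{-1/2}` on `(t, ∞)` and by `0` on `(0, t]`. -/
def cutInv (t : Ioi (0 : ℝ)) : Op (HalfL2 K) :=
  mulOp K (indicator (Ioi (t : ℝ)) fun y => (√(1 - Real.exp (-y)))⁻¹) (memLp_cutInv t)

variable {K}

theorem cut_mul_aux (t : Ioi (0 : ℝ)) (x : ℝ) :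
    √(1 - Real.exp (-x)) * indicator (Ioi (t : ℝ)) (fun y => (√(1 - Real.exp (-y)))⁻¹) x
      = indicator (Ioi (t : ℝ)) (fun _ => (1 : ℝ)) x := by
  by_cases hx : x ∈ Ioi (t : ℝ)
  · rw [indicator_of_mem hx, indicator_of_mem hx]
    have hx0 : 0 < x := lt_trans t.2 hx
    have : Real.exp (-x) < 1 := Real.exp_lt_one_iff.2 (by linarith)
    exact mul_inv_cancel₀ (Real.sqrt_pos.2 (by linarith)).ne'
  · rw [indicator_of_notMem hx, indicator_of_notMem hx, mul_zero]

theorem rootD_mul_cutInv (t : Ioi (0 : ℝ)) : rootD K * cutInv K t = cutE K t :=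
  mulOp_mul K _ _ _ _ _ _ fun x _ => cut_mul_aux t x

theorem cutInv_mul_rootD (t : Ioi (0 : ℝ)) : cutInv K t * rootD K = cutE K t :=
  mulOp_mul K _ _ _ _ _ _ fun x _ => by rw [mul_comm]; exact cut_mul_aux t x

/-- The map `Λ : B(K) → B(K ⊗ L²(0, ∞))`, `(Λ(A) f)(x) = e^{-x} A f(x)`. -/
def lam : Op K →L[ℂ] Op (HalfL2 K) :=
  LinearMap.mkContinuous
    { toFun := fun A => mulOp K (fun x => Real.exp (-x)) memLp_exp * A.compLpL 2 halfLine
      map_add' := fun A B => by rw [ContinuousLinearMap.add_compLpL, mul_add]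
      map_smul' := fun c A => by
        rw [ContinuousLinearMap.smul_compLpL, mul_smul_comm]; rfl }
    ‖mulOp K (fun x => Real.exp (-x)) memLp_exp‖ fun A =>
      (norm_mul_le _ _).trans
        (mul_le_mul_of_nonneg_left (ContinuousLinearMap.norm_compLpL_le A) (norm_nonneg _))

theorem lam_coeFn (A : Op K) (f : HalfL2 K) :
    lam A f =ᵐ[halfLine] fun x => ((Real.exp (-x) : ℝ) : ℂ) • A (f x) := by
  have h : lam A f = mulOp K (fun x => Real.exp (-x)) memLp_exp (A.compLpL 2 halfLine f) := rfl
  rw [h]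
  filter_upwards [mulOp_coeFn _ memLp_exp (A.compLpL 2 halfLine f),
    ContinuousLinearMap.coeFn_compLpL A f] with x h1 h2
  rw [h1, h2]

theorem rootD_mul_rootD : rootD K * rootD K = 1 - lam (1 : Op K) := by
  ext1 f
  apply Lp.ext
  filter_upwards [mulOp_coeFn _ memLp_sqrt (rootD K f), mulOp_coeFn _ memLp_sqrt f,
    lam_coeFn (1 : Op K) f, Lp.coeFn_sub f (lam (1 : Op K) f),
    ae_restrict_mem measurableSet_Ioi] with x h1 h2 h3 h4 h5
  have hx0 : (0 : ℝ) < x := h5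
  have hx : Real.exp (-x) < 1 := Real.exp_lt_one_iff.2 (by linarith)
  have e1 : (rootD K * rootD K) f = mulOp K _ memLp_sqrt (rootD K f) := rfl
  have e2 : (1 - lam (1 : Op K)) f = f - lam (1 : Op K) f := rfl
  have e3 : (rootD K f) x = ((√(1 - Real.exp (-x)) : ℝ) : ℂ) • f x := h2
  rw [e1, e2, h1, h4, Pi.sub_apply, h3, e3, smul_smul, ← Complex.ofReal_mul,
    Real.mul_self_sqrt (by linarith)]
  simp [sub_smul]

theorem rootD_nonneg : 0 ≤ rootD K := by
  rw [ContinuousLinearMap.nonneg_iff_isPositive, ContinuousLinearMap.isPositive_iff_complex]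
  intro f
  have hval : inner ℂ (rootD K f) f
      = ((∫ x, √(1 - Real.exp (-x)) * ‖f x‖ ^ 2 ∂halfLine : ℝ) : ℂ) := by
    rw [L2.inner_def, ← integral_complex_ofReal]
    apply integral_congr_ae
    filter_upwards [mulOp_coeFn _ memLp_sqrt f] with x hx
    have e3 : (rootD K f) x = ((√(1 - Real.exp (-x)) : ℝ) : ℂ) • f x := hx
    rw [e3, inner_smul_left, inner_self_eq_norm_sq_to_K]
    simp
  rw [hval]
  refine ⟨by simp, ?_⟩
  simp only [RCLike.re_to_complex, Complex.ofReal_re]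
  exact integral_nonneg fun x => by positivity

/-! ### Preduals -/

/-- The vector functional `A ↦ (x, A y)`. -/
def vecFun (x y : K) : StrongDual ℂ (Op K) :=
  (innerSL ℂ x).comp (ContinuousLinearMap.apply ℂ K y)

@[simp]
theorem vecFun_apply (x y : K) (A : Op K) : vecFun x y A = inner ℂ x (A y) := rfl

variable (K) in
/-- The normal (σ-weakly continuous) linear functionals on `B(K)`: the norm closure of the linear
span of the vector functionals in the Banach space dual of `B(K)`. -/
def normalFunctionals : Submodule ℂ (StrongDual ℂ (Op K)) :=
  (Submodule.span ℂ (range fun p : K × K => vecFun p.1 p.2)).topologicalClosure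

variable (K) in
/-- The predual `B(K)_*` of `B(K)`: the normal functionals, with the norm of the dual. -/
def Predual : Type _ := normalFunctionals K

instance : NormedAddCommGroup (Predual K) :=
  inferInstanceAs (NormedAddCommGroup (normalFunctionals K))

instance : NormedSpace ℂ (Predual K) := inferInstanceAs (NormedSpace ℂ (normalFunctionals K))

/-- The functional underlying an element of the predual. -/
def func : Predual K →ₗᵢ[ℂ] StrongDual ℂ (Op K) := (normalFunctionals K).subtypeₗᵢ

/-- A normal functional, as an element of the predual. -/
def Predual.mk (ρ : StrongDual ℂ (Op K)) (hρ : ρ ∈ normalFunctionals K) : Predual K := Subtype.mk ρ hρ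

@[simp]
theorem func_mk (ρ : StrongDual ℂ (Op K)) (hρ : ρ ∈ normalFunctionals K) :
    func (Predual.mk ρ hρ) = ρ := rfl

theorem func_mem (ρ : Predual K) : func ρ ∈ normalFunctionals K := Subtype.property ρ

theorem vecFun_mem (x y : K) : vecFun x y ∈ normalFunctionals K :=
  Submodule.le_topologicalClosure _ (Submodule.subset_span ⟨(x, y), rfl⟩)

theorem comp_mem_normal {L M : Type*} [NormedAddCommGroup L] [InnerProductSpace ℂ L]
    [NormedAddCommGroup M] [InnerProductSpace ℂ M] [CompleteSpace L] [CompleteSpace M]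
    (T : Op L →L[ℂ] Op M) (hT : ∀ x y, (vecFun x y).comp T ∈ normalFunctionals L)
    {ρ : StrongDual ℂ (Op M)} (hρ : ρ ∈ normalFunctionals M) : ρ.comp T ∈ normalFunctionals L := by
  let F : StrongDual ℂ (Op M) →L[ℂ] StrongDual ℂ (Op L) :=
    (ContinuousLinearMap.compL ℂ (Op L) (Op M) ℂ).flip T
  have hle : normalFunctionals M ≤ (normalFunctionals L).comap F.toLinearMap := by
    refine Submodule.topologicalClosure_minimal _ ?_ ?_
    · rw [Submodule.span_le]
      rintro _ ⟨p, rfl⟩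
      exact hT p.1 p.2
    · exact (Submodule.isClosed_topologicalClosure _).preimage F.continuous
  exact hle hρ

/-- The predual map `ρ ↦ ρ ∘ T` of a normal map `T : B(L) → B(M)`. -/
def predualMap {L M : Type*} [NormedAddCommGroup L] [InnerProductSpace ℂ L]
    [NormedAddCommGroup M] [InnerProductSpace ℂ M] [CompleteSpace L] [CompleteSpace M]
    (T : Op L →L[ℂ] Op M) (hT : ∀ x y, (vecFun x y).comp T ∈ normalFunctionals L) :
    Predual M →ₗ[ℂ] Predual L where
  toFun ρ := Predual.mk ((func ρ).comp T) (comp_mem_normal T hT (func_mem ρ))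
  map_add' _ _ := rfl
  map_smul' _ _ := rfl

theorem vecFun_comp_conj (X : Op K) (x y : K) :
    (vecFun x y).comp (ContinuousLinearMap.mulLeftRight ℂ (Op K) X X) ∈ normalFunctionals K := by
  have h : (vecFun x y).comp (ContinuousLinearMap.mulLeftRight ℂ (Op K) X X)
      = vecFun (ContinuousLinearMap.adjoint X x) (X y) := by
    ext A
    simp [ContinuousLinearMap.mulLeftRight_apply, ContinuousLinearMap.adjoint_inner_left]
  rw [h]
  exact vecFun_mem _ _

theorem continuous_vecFun : Continuous fun p : K × K => vecFun p.1 p.2 := by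
  have h : (fun p : K × K => vecFun p.1 p.2) = fun p : K × K =>
      (ContinuousLinearMap.compL ℂ (Op K) K ℂ) (innerSL ℂ p.1)
        (ContinuousLinearMap.apply ℂ K p.2) := rfl
  rw [h]
  fun_prop

theorem vecFun_comp_lam (f g : HalfL2 K) : (vecFun f g).comp lam ∈ normalFunctionals K := by
  refine Lp.induction (by norm_num) (fun f : HalfL2 K => (vecFun f g).comp lam ∈ normalFunctionals K)
    ?_ ?_ ?_ f
  · intro c s hs hμs
    have hint : IntegrableOn (mulOp K (fun x => Real.exp (-x)) memLp_exp g) s halfLine :=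
      integrableOn_Lp_of_measure_ne_top _ fact_one_le_two_ennreal.elim hμs.ne
    have h : (vecFun (Lp.simpleFunc.indicatorConst 2 hs hμs.ne c : HalfL2 K) g).comp lam
        = vecFun c (∫ x in s, mulOp K (fun x => Real.exp (-x)) memLp_exp g x ∂halfLine) := by
      ext A
      rw [ContinuousLinearMap.comp_apply, vecFun_apply, vecFun_apply,
        Lp.simpleFunc.coe_indicatorConst, L2.inner_indicatorConstLp_eq_inner_setIntegral,
        ← ContinuousLinearMap.integral_comp_comm A hint]
      congr 1
      apply integral_congr_ae
      apply ae_restrict_of_ae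
      filter_upwards [lam_coeFn A g, mulOp_coeFn _ memLp_exp g] with x h1 h2
      rw [h1, h2, map_smul]
    rw [h]
    exact vecFun_mem _ _
  · intro f₁ f₂ h₁ h₂ _ hf₁ hf₂
    have h : (vecFun (h₁.toLp f₁ + h₂.toLp f₂ : HalfL2 K) g).comp lam
        = (vecFun (h₁.toLp f₁) g).comp lam + (vecFun (h₂.toLp f₂) g).comp lam := by
      ext A
      simp
    rw [h]
    exact add_mem hf₁ hf₂
  · have hc : Continuous fun f : HalfL2 K => (vecFun f g).comp (lam (K := K)) :=
      ((ContinuousLinearMap.compL ℂ (Op K) (Op (HalfL2 K)) ℂ).flip lam).continuous.comp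
        (continuous_vecFun.comp (Continuous.prodMk continuous_id continuous_const))
    exact (Submodule.isClosed_topologicalClosure _).preimage hc

/-- The predual map `Λ̂ : B(K ⊗ L²(0, ∞))_* → B(K)_*` of `Λ`, so `Λ̂(σ)(A) = σ(Λ(A))`. -/
def lamHat : Predual (HalfL2 K) →ₗ[ℂ] Predual K := predualMap lam vecFun_comp_lam

/-- Positive normal functionals. -/
def IsPosFunctional (ρ : Predual K) : Prop :=
  ∀ A : Op K, 0 ≤ A → 0 ≤ func ρ A

/-- A matrix `(ρ i j)` of normal functionals is positive if the functional
`(B i j) ↦ ∑ i j, ρ i j (B i j)` is positive on matrices over `B(K)`. Every positive matrix is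
a sum of matrices of the form `(B i)* (B j)`. -/
def IsPosMatrix {n : ℕ} (ρ : Fin n → Fin n → Predual K) : Prop :=
  ∀ B : Fin n → Op K, 0 ≤ ∑ i, ∑ j, func (ρ i j) (star (B i) * B j)

/-- Complete positivity of a linear map between preduals: it sends positive matrices of
functionals to positive matrices of functionals, for all sizes. -/
def IsCP {L M : Type*} [NormedAddCommGroup L] [InnerProductSpace ℂ L]
    [NormedAddCommGroup M] [InnerProductSpace ℂ M] [CompleteSpace L] [CompleteSpace M]
    (φ : Predual L →ₗ[ℂ] Predual M) : Prop :=
  ∀ (n : ℕ) (ρ : Fin n → Fin n → Predual L), IsPosMatrix ρ → IsPosMatrix fun i j => φ (ρ i j)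

/-! ### Boundary weights -/

variable (K) in
/-- The linear map `A ↦ (I - Λ(I))^{1/2} A (I - Λ(I))^{1/2}`. -/
def conjD : Op (HalfL2 K) →ₗ[ℂ] Op (HalfL2 K) :=
  (ContinuousLinearMap.mulLeftRight ℂ (Op (HalfL2 K)) (rootD K) (rootD K)).toLinearMap

theorem conjD_apply (A : Op (HalfL2 K)) : conjD K A = rootD K * A * rootD K := rfl

variable (K) in
/-- The algebra `𝔄(H) = (I - Λ(I))^{1/2} B(H) (I - Λ(I))^{1/2}`, where `H = K ⊗ L²(0, ∞)`. -/
def BdryAlg : Submodule ℂ (Op (HalfL2 K)) := LinearMap.range (conjD K)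

variable (K) in
/-- The surjection `A ↦ (I - Λ(I))^{1/2} A (I - Λ(I))^{1/2}` of `B(H)` onto `𝔄(H)`. -/
def toAlg : Op (HalfL2 K) →ₗ[ℂ] BdryAlg K := (conjD K).rangeRestrict

/-- The element `I - Λ(I)` of `𝔄(H)`. -/
def oneSubLam : BdryAlg K :=
  ⟨1 - lam (1 : Op K), 1, by rw [conjD_apply, mul_one, rootD_mul_rootD]⟩

theorem cut_mem (t : Ioi (0 : ℝ)) (A : Op (HalfL2 K)) : cutE K t * A * cutE K t ∈ BdryAlg K :=
  ⟨cutInv K t * A * cutInv K t, by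
    rw [conjD_apply]
    nth_rewrite 1 [← rootD_mul_cutInv]
    rw [← cutInv_mul_rootD]
    simp only [mul_assoc]⟩

/-- The element `A|_t = E(t, ∞) A E(t, ∞)` of `𝔄(H)`. -/
def cut (t : Ioi (0 : ℝ)) (A : Op (HalfL2 K)) : BdryAlg K := ⟨cutE K t * A * cutE K t, cut_mem t A⟩

theorem toAlg_cutInv (t : Ioi (0 : ℝ)) (A : Op (HalfL2 K)) :
    toAlg K (cutInv K t * A * cutInv K t) = cut t A := by
  apply Subtype.ext
  change rootD K * (cutInv K t * A * cutInv K t) * rootD K = cutE K t * A * cutE K t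
  nth_rewrite 1 [← rootD_mul_cutInv]
  rw [← cutInv_mul_rootD]
  simp only [mul_assoc]

variable (K) in
/-- The boundary weights `𝔄(H)_*`: linear functionals `μ` on `𝔄(H)` such that
`A ↦ μ((I - Λ(I))^{1/2} A (I - Λ(I))^{1/2})` is a normal bounded functional on `B(H)`. -/
def BdryWeight : Submodule ℂ (Module.Dual ℂ (BdryAlg K)) where
  carrier := {μ | ∃ l ∈ normalFunctionals (HalfL2 K), ∀ A, μ (toAlg K A) = l A}
  zero_mem' := ⟨0, zero_mem _, fun _ => rfl⟩
  add_mem' := by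
    rintro μ ν ⟨l, hl, h⟩ ⟨m, hm, h'⟩
    exact ⟨l + m, add_mem hl hm, fun A => by simp [h, h']⟩
  smul_mem' := by
    rintro c μ ⟨l, hl, h⟩
    exact ⟨c • l, Submodule.smul_mem _ _ hl, fun A => by simp [h]⟩

/-- A boundary weight is positive if it is nonnegative on positive operators in `𝔄(H)`. -/
def IsPosWeight (μ : BdryWeight K) : Prop :=
  ∀ A : BdryAlg K, 0 ≤ (A : Op (HalfL2 K)) → 0 ≤ μ.1 A

/-- The normal functional `A ↦ μ((I - Λ(I))^{1/2} A (I - Λ(I))^{1/2})` of a boundary weight. -/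
def normalPart : BdryWeight K →ₗ[ℂ] Predual (HalfL2 K) where
  toFun μ := Predual.mk μ.2.choose μ.2.choose_spec.1
  map_add' μ ν := by
    apply (func (K := HalfL2 K)).injective
    ext A
    have h1 := (μ + ν).2.choose_spec.2 A
    have h2 := μ.2.choose_spec.2 A
    have h3 := ν.2.choose_spec.2 A
    change (μ + ν).2.choose A = μ.2.choose A + ν.2.choose A
    rw [← h1, ← h2, ← h3]
    rfl
  map_smul' c μ := by
    apply (func (K := HalfL2 K)).injective
    ext A
    have h1 := (c • μ).2.choose_spec.2 A
    have h2 := μ.2.choose_spec.2 A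
    change (c • μ).2.choose A = c • μ.2.choose A
    rw [← h1, ← h2]
    rfl

theorem normalPart_apply (μ : BdryWeight K) (A : Op (HalfL2 K)) :
    func (normalPart μ) A
      = μ.1 (toAlg K A) :=
  (μ.2.choose_spec.2 A).symm

/-- The truncation `μ|_t` of a boundary weight: the normal functional on `B(H)` given by
`μ|_t(A) = μ(E(t, ∞) A E(t, ∞))`; see `trunc_apply`. -/
def trunc (t : Ioi (0 : ℝ)) : BdryWeight K →ₗ[ℂ] Predual (HalfL2 K) :=
  (predualMap (ContinuousLinearMap.mulLeftRight ℂ (Op (HalfL2 K)) (cutInv K t) (cutInv K t))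
    (vecFun_comp_conj (cutInv K t))).comp normalPart

theorem trunc_apply (t : Ioi (0 : ℝ)) (μ : BdryWeight K) (A : Op (HalfL2 K)) :
    func (trunc t μ) A = μ.1 (cut t A) := by
  rw [← toAlg_cutInv, ← normalPart_apply]
  rfl

/-! ### Boundary weight maps and `q`-weight maps -/

variable (K) in
/-- Boundary weight maps: linear maps from `B(K)_*` to `𝔄(H)_*`. -/
abbrev BdryWeightMap : Type _ := Predual K →ₗ[ℂ] BdryWeight K

/-- Complete positivity of a boundary weight map. The positive matrices over `𝔄(H)` are the
matrices `((I - Λ(I))^{1/2} C i j (I - Λ(I))^{1/2})` with `C` a positive matrix over `B(H)`, and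
these `C` are sums of matrices of the form `(A i)* (A j)`. -/
def IsCPWeightMap (ω : BdryWeightMap K) : Prop :=
  ∀ (n : ℕ) (ρ : Fin n → Fin n → Predual K), IsPosMatrix ρ → ∀ A : Fin n → Op (HalfL2 K),
    0 ≤ ∑ i, ∑ j, (ω (ρ i j)).1 (toAlg K (star (A i) * A j))

/-- The truncated boundary weight map `ω|_t : B(K)_* → B(H)_*`. -/
def truncMap (ω : BdryWeightMap K) (t : Ioi (0 : ℝ)) : Predual K →ₗ[ℂ] Predual (HalfL2 K) :=
  (trunc t).comp ω

/-- The map `I + Λ̂ ω|_t` on `B(K)_*`. -/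
def onePlus (ω : BdryWeightMap K) (t : Ioi (0 : ℝ)) : Module.End ℂ (Predual K) :=
  1 + lamHat.comp (truncMap ω t)

/-- The (predual) generalized boundary representation `π̂_t = ω|_t (I + Λ̂ ω|_t)⁻¹`; it is
meaningful when `I + Λ̂ ω|_t` is invertible. -/
def genRep (ω : BdryWeightMap K) (t : Ioi (0 : ℝ)) : Predual K →ₗ[ℂ] Predual (HalfL2 K) :=
  (truncMap ω t).comp (Ring.inverse (onePlus ω t))

/-- `q`-weight maps over `K`. -/
structure IsQWeightMap (ω : BdryWeightMap K) : Prop where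
  cp : IsCPWeightMap ω
  normalized : ∀ ρ : Predual K, IsPosFunctional ρ →
    (ω ρ).1 oneSubLam ≤ func ρ 1
  isUnit : ∀ t, IsUnit (onePlus ω t)
  genRep_cp : ∀ t, IsCP (genRep ω t)
  genRep_contraction : ∀ t ρ, ‖genRep ω t ρ‖ ≤ ‖ρ‖

/-- `η` is a `q`-subordinate of `ω`: both are `q`-weight maps, and for every `t > 0` the
difference of their generalized boundary representations is completely positive. -/
def IsQSubordinate (η ω : BdryWeightMap K) : Prop :=
  IsQWeightMap η ∧ IsQWeightMap ω ∧ ∀ t, IsCP (genRep ω t - genRep η t)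

/-- A `q`-weight map is `q`-pure if the set of its `q`-subordinates is totally ordered by
`q`-subordination. -/
def IsQPure (ω : BdryWeightMap K) : Prop :=
  IsQWeightMap ω ∧ ∀ η₁ η₂ : BdryWeightMap K, IsQSubordinate η₁ ω → IsQSubordinate η₂ ω →
    IsQSubordinate η₁ η₂ ∨ IsQSubordinate η₂ η₁

/-- The range of the dualized boundary weight map `ω̆ : 𝔄(H) → B(K)`, where `B = ω̆(A)` is the
operator with `ρ(B) = ω(ρ)(A)` for all `ρ ∈ B(K)_*`. -/
def dualRange (ω : BdryWeightMap K) : Submodule ℂ (Op K) where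
  carrier := {B | ∃ A : BdryAlg K, ∀ ρ : Predual K,
    func ρ B = (ω ρ).1 A}
  zero_mem' := ⟨0, fun ρ => by simp⟩
  add_mem' := by
    rintro B C ⟨A, h⟩ ⟨A', h'⟩
    exact ⟨A + A', fun ρ => by simp [h, h']⟩
  smul_mem' := by
    rintro c B ⟨A, h⟩
    exact ⟨c • A, fun ρ => by simp [h]⟩

/-- `ω` has (finite) range rank `r`. -/
def HasRangeRank (ω : BdryWeightMap K) (r : ℕ) : Prop := Module.rank ℂ (dualRange ω) = r

/-- The boundary weight map `ρ ↦ ρ(e) μ`. -/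
def rankOneMap (e : Op K) (μ : BdryWeight K) : BdryWeightMap K where
  toFun ρ := func ρ e • μ
  map_add' ρ σ := by simp [add_smul]
  map_smul' c ρ := by simp [mul_smul]

/-- The function `h(t) = μ(Λ(e)|_t) / (1 + ν(Λ(e)|_t))` on `(0, ∞)`; the values `μ(Λ(e)|_t)` and
`ν(Λ(e)|_t)` are real when `e`, `μ` and `ν` are positive. -/
def hFun (μ ν : BdryWeight K) (e : Op K) (t : Ioi (0 : ℝ)) : ℝ :=
  (μ.1 (cut t (lam e))).re /
    (1 + (ν.1 (cut t (lam e))).re)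

/-- `κ = sup {h(t) : t > 0}`. -/
def kappa (μ ν : BdryWeight K) (e : Op K) : ℝ := sSup (range (hFun μ ν e))

end Defs

end

end QWeight

namespace QWeight

noncomputable section

open MeasureTheory Set

open Filter Topology

/-! ### Multiplication operators, order properties of `lam`, and strong convergence of the cut-offs.
-/

section Operators

variable {K : Type*} [NormedAddCommGroup K] [InnerProductSpace ℂ K] [CompleteSpace K]

/-! Write `a_ij = μ_i(Λ(e_j)|_t)`. Since `ω|_t` has the form `e₁ ⊗ μ₁|_t + e₂ ⊗ μ₂|_t`, inverting `I
+ Λ̂ω|_t` amounts to inverting a 2 × 2 matrix. With `d = (1 + a₁₁)(1 + a₂₂) - a₁₂ a₂₁` this gives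
`π̂_t = e₁ ⊗ m₁ + e₂ ⊗ m₂`, where `d m₁ = (1 + a₂₂) μ₁|_t - a₁₂ μ₂|_t` and symmetrically for `m₂`
(`exists_genRep_coeff`). The square condition on `e₁, e₂` decouples the coefficients: complete
positivity forces `m₁, m₂ ≥ 0`, and contractivity forces `m_i(I) ≤ 1`.

Moreover `d > 0` (`det_pos`), so with `h(t) = a₁₂ / (1 + a₂₂)` the functional `(μ₁ - h(t) μ₂)|_t` is
positive. Evaluating it on `Λ(e₂)` shows that `h ≤ 1` and that `h` decreases in `t`. Hence `κ₁` is
finite, and positivity survives in the limit: `(μ₁ - κ₁ μ₂)|_t ≥ 0` for every `t`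
(`trunc_sub_kappa_pos`). The representation of `η` differs from the `e₁` part of `π̂_t` by `e₁`
tensored with a nonnegative multiple of `m₂`, which gives `η ≤_q ω` (`isQSubordinate_left`).

If `η ≤_q ν`, decoupling makes a negative multiple of the weight of `η` positive, so `η = 0`; this
is incomparability. Range rank two excludes `μ₁ = κ₁ μ₂` and `μ₂ = κ₂ μ₁`, since either makes `ω`
rank one.

If `ω` is `q`-pure, then `η` or `ν` vanishes, say `μ₁ = κ₁ μ₂`, and `ω = (κ₁ e₁ + e₂) ⊗ μ₂`. Then `ν
= c e₂ ⊗ μ₂` with `c = 1 - κ₁ κ₂`, and `ν` must be comparable with the subordinate `ω / 2`. If `c ≠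
0`, `ω / 2 ≤_q ν` fails at the coefficient of `e₁`, while `ν ≤_q ω / 2` bounds `μ₂(Λ(e₁)|_t)` so
tightly that `c² ≤ 0`. Thus `c = 0`, and `κ₁, κ₂ ≤ 1` with `κ₁ κ₂ = 1` yields `μ₁ = μ₂`. -/

theorem star_mulOp (φ : ℝ → ℝ) (hφ : MemLp (fun x => (φ x : ℂ)) ⊤ halfLine) :
    star (mulOp K φ hφ) = mulOp K φ hφ := by
  rw [ContinuousLinearMap.star_eq_adjoint, eq_comm, ContinuousLinearMap.eq_adjoint_iff]
  intro f g
  rw [L2.inner_def, L2.inner_def]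
  apply integral_congr_ae
  filter_upwards [mulOp_coeFn φ hφ f, mulOp_coeFn φ hφ g] with x h1 h2
  rw [h1, h2, inner_smul_left, inner_smul_right, Complex.conj_ofReal]

theorem mulOp_mul_lam (φ : ℝ → ℝ) (hφ : MemLp (fun x => (φ x : ℂ)) ⊤ halfLine) (A : Op K) :
    mulOp K φ hφ * lam A = lam A * mulOp K φ hφ := by
  ext1 f
  apply Lp.ext
  change mulOp K φ hφ (lam A f) =ᵐ[halfLine] lam A (mulOp K φ hφ f)
  filter_upwards [mulOp_coeFn φ hφ (lam A f), lam_coeFn A f, mulOp_coeFn φ hφ f,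
    lam_coeFn A (mulOp K φ hφ f)] with x h1 h2 h3 h4
  rw [h1, h2, h4, h3, map_smul, smul_comm]

theorem lam_nonneg {A : Op K} (hA : 0 ≤ A) : 0 ≤ lam A := by
  rw [ContinuousLinearMap.nonneg_iff_isPositive] at hA ⊢
  rw [ContinuousLinearMap.isPositive_iff_complex]
  intro f
  have hval : inner ℂ (lam A f) f
      = ((∫ x, Real.exp (-x) * (inner ℂ (A (f x)) (f x)).re ∂halfLine : ℝ) : ℂ) := by
    rw [L2.inner_def, ← integral_complex_ofReal]
    apply integral_congr_ae
    filter_upwards [lam_coeFn A f] with x hx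
    have h := ((ContinuousLinearMap.isPositive_iff_complex A).1 hA (f x)).1
    rw [hx, inner_smul_left, Complex.conj_ofReal, ← h]
    simp
  rw [hval]
  refine ⟨by simp, ?_⟩
  simp only [RCLike.re_to_complex, Complex.ofReal_re]
  refine integral_nonneg fun x => mul_nonneg (Real.exp_pos _).le ?_
  exact ((ContinuousLinearMap.isPositive_iff_complex A).1 hA (f x)).2

theorem lam_one_le : lam (1 : Op K) ≤ 1 := by
  rw [← sub_nonneg, ← rootD_mul_rootD]
  have h : star (rootD K) = rootD K := star_mulOp _ _
  nth_rewrite 1 [← h]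
  exact star_mul_self_nonneg _

theorem lam_mono {A B : Op K} (h : A ≤ B) : lam A ≤ lam B := by
  rw [← sub_nonneg, ← map_sub]
  exact lam_nonneg (sub_nonneg.2 h)

theorem star_cutE (t : ℝ) : star (cutE K t) = cutE K t := star_mulOp _ _

theorem inner_cutE_left (t : ℝ) (f g : HalfL2 K) :
    inner ℂ (cutE K t f) g = inner ℂ f (cutE K t g) := by
  have h : ContinuousLinearMap.adjoint (cutE K t) = cutE K t := star_cutE t
  rw [← ContinuousLinearMap.adjoint_inner_right, h]

theorem cutE_mul_lam (t : ℝ) (A : Op K) : cutE K t * lam A = lam A * cutE K t :=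
  mulOp_mul_lam _ _ _

theorem indicator_Ioi_mul {s t : ℝ} (h : t ≤ s) (x : ℝ) :
    indicator (Ioi s) (fun _ => (1 : ℝ)) x * indicator (Ioi t) (fun _ => 1) x
      = indicator (Ioi s) (fun _ => 1) x := by
  by_cases hx : x ∈ Ioi s
  · have : x ∈ Ioi t := lt_of_le_of_lt h hx
    simp [indicator_of_mem hx, indicator_of_mem this]
  · simp [indicator_of_notMem hx]

theorem cutE_mul_cutE_of_le {s t : ℝ} (h : t ≤ s) : cutE K s * cutE K t = cutE K s :=
  mulOp_mul K _ _ _ _ _ _ fun x _ => indicator_Ioi_mul h x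

theorem cutE_mul_cutE_of_le' {s t : ℝ} (h : t ≤ s) : cutE K t * cutE K s = cutE K s :=
  mulOp_mul K _ _ _ _ _ _ fun x _ => by rw [mul_comm]; exact indicator_Ioi_mul h x

theorem norm_cutE_le (t : ℝ) : ‖cutE K t‖ ≤ 1 := by
  have h : ‖cutE K t‖ * ‖cutE K t‖ = ‖cutE K t‖ := by
    have := CStarRing.norm_star_mul_self (x := cutE K t)
    rw [star_cutE, cutE_mul_cutE_of_le le_rfl] at this
    exact this.symm
  by_contra hlt
  nlinarith [not_le.1 hlt]

/-- Commutation removes the off-diagonal blocks, so the difference is the compression of `X` to the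
complementary projection. -/
theorem sub_cut_nonneg {X : Op (HalfL2 K)} (hX : 0 ≤ X) (t : ℝ)
    (h : cutE K t * X = X * cutE K t) : 0 ≤ X - cutE K t * X * cutE K t := by
  have hE := cutE_mul_cutE_of_le (K := K) (le_refl t)
  have h1 : X - cutE K t * X * cutE K t = star (1 - cutE K t) * X * (1 - cutE K t) := by
    rw [star_sub, star_one, star_cutE, h, mul_assoc, hE, sub_mul, one_mul, h, mul_sub, mul_one,
      sub_mul, mul_assoc X, hE, sub_self, sub_zero]
  rw [h1]
  exact star_left_conjugate_nonneg hX _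

/-- The squared distance is the integral of `‖f‖²` over `(0, 1/(n+1)]`, which vanishes by dominated
convergence. -/
theorem tendsto_cutE (f : HalfL2 K) :
    Tendsto (fun n : ℕ => cutE K (1 / ((n : ℝ) + 1)) f) atTop (𝓝 f) := by
  rw [tendsto_iff_norm_sub_tendsto_zero]
  have hsq : Tendsto (fun n : ℕ => ‖cutE K (1 / ((n : ℝ) + 1)) f - f‖ ^ 2) atTop (𝓝 0) := by
    have hval (n : ℕ) : ‖cutE K (1 / ((n : ℝ) + 1)) f - f‖ ^ 2
        = ∫ x, indicator (Iic (1 / ((n : ℝ) + 1))) (fun y => ‖f y‖ ^ 2) x ∂halfLine := by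
      rw [← inner_self_eq_norm_sq (𝕜 := ℂ), L2.inner_def, ← integral_re]
      · apply integral_congr_ae
        filter_upwards [mulOp_coeFn _ (memLp_indicator (1 / ((n : ℝ) + 1))) f,
          Lp.coeFn_sub (cutE K (1 / ((n : ℝ) + 1)) f) f] with x h1 h2
        have h1' : cutE K (1 / ((n : ℝ) + 1)) f x = _ := h1
        rw [h2, Pi.sub_apply, h1', inner_self_eq_norm_sq]
        by_cases hx : x ≤ 1 / ((n : ℝ) + 1)
        · rw [indicator_of_mem (show x ∈ Iic _ from hx),
            indicator_of_notMem (by simpa using hx)]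
          simp
        · rw [indicator_of_notMem (show x ∉ Iic _ from hx),
            indicator_of_mem (by simpa using hx)]
          simp
      · exact L2.integrable_inner _ _
    simp_rw [hval]
    have hint : Integrable (fun y => ‖f y‖ ^ 2) halfLine :=
      (memLp_two_iff_integrable_sq_norm (Lp.aestronglyMeasurable f)).1 (Lp.memLp f)
    have h0 : (0 : ℝ) = ∫ x, (0 : ℝ) ∂halfLine := by simp
    rw [h0]
    apply tendsto_integral_of_dominated_convergence (fun y => ‖f y‖ ^ 2)
    · exact fun n => hint.aestronglyMeasurable.indicator measurableSet_Iic
    · exact hint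
    · refine fun n => Eventually.of_forall fun x => ?_
      rw [Real.norm_of_nonneg (indicator_nonneg (fun _ _ => by positivity) _)]
      exact indicator_le_self' (fun _ _ => by positivity) x
    · filter_upwards [ae_restrict_mem measurableSet_Ioi] with x hx
      apply tendsto_const_nhds.congr'
      filter_upwards [tendsto_one_div_add_atTop_nhds_zero_nat.eventually_lt_const (mem_Ioi.1 hx)] with n hn
      rw [indicator_of_notMem (by simpa using hn)]
  have := hsq.sqrt
  simpa [Real.sqrt_sq] using this

end Operators

/-! ### Normal functionals along cut-offs, and the norm of a positive functional. -/

section Functionals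

variable {K : Type*} [NormedAddCommGroup K] [InnerProductSpace ℂ K] [CompleteSpace K]

theorem norm_cutE_conj_le (t : ℝ) (C : Op (HalfL2 K)) : ‖cutE K t * C * cutE K t‖ ≤ ‖C‖ := by
  refine (norm_mul_le _ _).trans ?_
  have h1 := (norm_mul_le (cutE K t) C).trans
    (mul_le_of_le_one_left (norm_nonneg C) (norm_cutE_le t))
  exact (mul_le_of_le_one_right (norm_nonneg _) (norm_cutE_le t)).trans h1

/-- An `ε/3` argument: the uniform bound on `u n` carries convergence from the span to its norm
closure. -/
theorem tendsto_apply_of_mem_topologicalClosure {E : Type*} [NormedAddCommGroup E]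
    [NormedSpace ℂ E] {S : Set (StrongDual ℂ E)} {u : ℕ → E} {c : E} (hu : ∀ n, ‖u n‖ ≤ ‖c‖)
    (hS : ∀ l ∈ S, Tendsto (fun n => l (u n)) atTop (𝓝 (l c))) {l : StrongDual ℂ E}
    (hl : l ∈ (Submodule.span ℂ S).topologicalClosure) :
    Tendsto (fun n => l (u n)) atTop (𝓝 (l c)) := by
  have hspan : ∀ m ∈ Submodule.span ℂ S, Tendsto (fun n => m (u n)) atTop (𝓝 (m c)) := by
    intro m hm
    induction hm using Submodule.span_induction with
    | mem m hm => exact hS m hm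
    | zero => simp
    | add m m' _ _ h h' => exact h.add h'
    | smul a m _ h => exact h.const_smul a
  have hl' : l ∈ closure (Submodule.span ℂ S : Set (StrongDual ℂ E)) := hl
  rw [Metric.tendsto_atTop]
  intro ε hε
  obtain ⟨m, hm, hdist⟩ := Metric.mem_closure_iff.1 hl' (ε / (3 * (‖c‖ + 1))) (by positivity)
  obtain ⟨N, hN⟩ := Metric.tendsto_atTop.1 (hspan m hm) (ε / 3) (by positivity)
  refine ⟨N, fun n hn => ?_⟩
  have key (x : E) (hx : ‖x‖ ≤ ‖c‖) : dist (l x) (m x) ≤ ε / 3 := by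
    rw [dist_eq_norm] at hdist ⊢
    calc ‖l x - m x‖ ≤ ‖l - m‖ * ‖x‖ := (l - m).le_opNorm x
      _ ≤ ε / (3 * (‖c‖ + 1)) * (‖c‖ + 1) := by gcongr; linarith
      _ = ε / 3 := by field_simp
  have h1 := key _ (hu n)
  have h2 := key c le_rfl
  have h3 := hN n hn
  rw [dist_comm] at h2
  exact (dist_triangle4 _ _ _ _).trans_lt (by linarith)

theorem tendsto_normal_cutE {l : StrongDual ℂ (Op (HalfL2 K))} (hl : l ∈ normalFunctionals (HalfL2 K))
    (C : Op (HalfL2 K)) :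
    Tendsto (fun n : ℕ => l (cutE K (1 / ((n : ℝ) + 1)) * C * cutE K (1 / ((n : ℝ) + 1))))
      atTop (𝓝 (l C)) := by
  refine tendsto_apply_of_mem_topologicalClosure (fun n => norm_cutE_conj_le _ C) ?_ hl
  rintro _ ⟨⟨f, g⟩, rfl⟩
  have heq (n : ℕ) : vecFun f g (cutE K (1 / ((n : ℝ) + 1)) * C * cutE K (1 / ((n : ℝ) + 1)))
      = inner ℂ (cutE K (1 / ((n : ℝ) + 1)) f) (C (cutE K (1 / ((n : ℝ) + 1)) g)) :=
    (inner_cutE_left _ _ _).symm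
  refine Tendsto.congr (fun n => (heq n).symm) ?_
  exact (tendsto_cutE f).inner ((C.continuous.tendsto _).comp (tendsto_cutE g))

theorem exists_eq_star_mul_self {A : Op K} (hA : 0 ≤ A) : ∃ B : Op K, A = star B * B :=
  CStarAlgebra.nonneg_iff_eq_star_mul_self.1 hA

theorem le_norm_smul_one {A : Op K} (hA : 0 ≤ A) : A ≤ ((‖A‖ : ℝ) : ℂ) • (1 : Op K) := by
  have h := (IsSelfAdjoint.of_nonneg hA).le_algebraMap_norm_self
  rwa [Algebra.algebraMap_eq_smul_one, ← Complex.coe_smul] at h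

theorem ofReal_smul_nonneg {r : ℝ} (hr : 0 ≤ r) {A : Op K} (hA : 0 ≤ A) : 0 ≤ (r : ℂ) • A := by
  rw [Complex.coe_smul]
  exact smul_nonneg hr hA

theorem IsPosFunctional.mono {p : Predual K} (hp : IsPosFunctional p) {A B : Op K} (h : A ≤ B) :
    func p A ≤ func p B := by
  rw [← sub_nonneg, ← map_sub]
  exact hp _ (sub_nonneg.2 h)

/-- Cauchy–Schwarz for the GNS form of `p`, applied to `1` and `A`, together with `A* A ≤ ‖A‖² I`.
-/
theorem IsPosFunctional.norm_apply_le {p : Predual K} (hp : IsPosFunctional p) (A : Op K) :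
    ‖func p A‖ ≤ (func p 1).re * ‖A‖ := by
  let f : Op K →ₚ[ℂ] ℂ := PositiveLinearMap.mk₀ (func p).toLinearMap hp
  have hf (X : Op K) : f X = func p X := rfl
  have h1 : (0 : ℂ) ≤ func p 1 := hp 1 zero_le_one
  have h := norm_inner_le_norm (𝕜 := ℂ) (f.toPreGNS 1) (f.toPreGNS A)
  rw [f.preGNS_inner_def, f.preGNS_norm_def, f.preGNS_norm_def] at h
  simp only [f.ofPreGNS_toPreGNS, star_one, one_mul, hf] at h
  refine h.trans ?_
  have h2 : func p (star A * A) ≤ ((‖A‖ ^ 2 : ℝ) : ℂ) * func p 1 := by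
    have hle := hp.mono (le_norm_smul_one (star_mul_self_nonneg A))
    rwa [CStarRing.norm_star_mul_self, map_smul, smul_eq_mul, ← sq] at hle
  have h3 : (func p (star A * A)).re ≤ ‖A‖ ^ 2 * (func p 1).re := by
    have := (Complex.le_def.1 h2).1
    rwa [Complex.re_ofReal_mul] at this
  have h4 : 0 ≤ (func p 1).re := (Complex.nonneg_iff.1 h1).1
  calc √(func p 1).re * √(func p (star A * A)).re
      ≤ √(func p 1).re * √(‖A‖ ^ 2 * (func p 1).re) := by gcongr
    _ = (func p 1).re * ‖A‖ := by
      rw [Real.sqrt_mul (by positivity), Real.sqrt_sq (norm_nonneg A), mul_left_comm,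
        Real.mul_self_sqrt h4, mul_comm]

end Functionals

/-! ### Complete positivity of maps of rank one. -/

section CompletePositivity

variable {K L : Type*} [NormedAddCommGroup K] [InnerProductSpace ℂ K] [CompleteSpace K]
  [NormedAddCommGroup L] [InnerProductSpace ℂ L] [CompleteSpace L]

@[simp]
theorem func_add_apply (ρ σ : Predual K) (A : Op K) : func (ρ + σ) A = func ρ A + func σ A := by
  simp

@[simp]
theorem func_smul_apply (c : ℂ) (ρ : Predual K) (A : Op K) : func (c • ρ) A = c * func ρ A := by
  simp

theorem Predual.ext_func {ρ σ : Predual K} (h : ∀ A, func ρ A = func σ A) : ρ = σ :=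
  (func (K := K)).injective (ContinuousLinearMap.ext h)

theorem func_sub_apply (ρ σ : Predual K) (A : Op K) : func (ρ - σ) A = func ρ A - func σ A := by
  simp

theorem posSemidef_of_forall_sum {n : ℕ} {P : Matrix (Fin n) (Fin n) ℂ}
    (h : ∀ v : Fin n → ℂ, 0 ≤ ∑ i, ∑ j, star (v i) * v j * P i j) : P.PosSemidef := by
  rw [← Matrix.isPositive_toEuclideanLin_iff, LinearMap.isPositive_iff_complex]
  intro x
  have h1 : inner ℂ (P.toEuclideanLin x) x = star (∑ i, ∑ j, star (x i) * x j * P i j) := by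
    rw [PiLp.inner_apply, star_sum]
    refine Finset.sum_congr rfl fun i _ => ?_
    simp only [Matrix.toLpLin_apply, Matrix.mulVec, dotProduct, RCLike.inner_apply, map_sum, star_sum,
      Finset.mul_sum]
    refine Finset.sum_congr rfl fun j _ => ?_
    simp
    ring
  have h2 := h x
  rw [h1]
  generalize ∑ i, ∑ j, star (x i) * x j * P i j = z at h2
  obtain ⟨h3, h4⟩ := Complex.nonneg_iff.1 h2
  exact ⟨Complex.ext (by simp) (by simp [← h4]), by simpa using h3⟩

/-- Schur product theorem: the Gram matrix of `m` on `F` is positive semidefinite, hence so is its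
Hadamard product with `P`. -/
theorem sum_posSemidef_mul_nonneg {n : ℕ} {P : Matrix (Fin n) (Fin n) ℂ} (hP : P.PosSemidef)
    {m : Predual L} (hm : IsPosFunctional m) (F : Fin n → Op L) :
    0 ≤ ∑ i, ∑ j, P i j * func m (star (F i) * F j) := by
  have hM : (Matrix.of fun i j => func m (star (F i) * F j)).PosSemidef := by
    apply posSemidef_of_forall_sum
    intro v
    have h : ∑ i, ∑ j, star (v i) * v j * func m (star (F i) * F j)
        = func m (star (∑ i, v i • F i) * ∑ j, v j • F j) := by
      simp only [star_sum, Finset.sum_mul_sum, map_sum, star_smul, smul_mul_smul_comm, map_smul,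
        smul_eq_mul]
    simp only [Matrix.of_apply]
    rw [h]
    exact hm _ (star_mul_self_nonneg _)
  -- The quadratic form of the Hadamard product at the all-ones vector is the double sum.
  have h := (hP.hadamard hM).dotProduct_mulVec_nonneg (fun _ => 1)
  simpa [Matrix.mulVec, dotProduct, Matrix.hadamard] using h

theorem IsPosMatrix.posSemidef {n : ℕ} {ρ : Fin n → Fin n → Predual K} (hρ : IsPosMatrix ρ)
    {c : Op K} (hc : 0 ≤ c) : (Matrix.of fun i j => func (ρ i j) c).PosSemidef := by
  obtain ⟨d, rfl⟩ := exists_eq_star_mul_self hc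
  apply posSemidef_of_forall_sum
  intro v
  have h := hρ fun i => v i • d
  simpa only [star_smul, smul_mul_smul_comm, map_smul, smul_eq_mul, Matrix.of_apply] using h

/-- The map `σ ↦ σ(c) m` between preduals. -/
def rankOne (c : Op K) (m : Predual L) : Predual K →ₗ[ℂ] Predual L where
  toFun σ := func σ c • m
  map_add' ρ σ := by simp [add_smul]
  map_smul' a ρ := by simp [mul_smul]

@[simp]
theorem rankOne_apply (c : Op K) (m : Predual L) (σ : Predual K) :
    rankOne c m σ = func σ c • m := rfl

theorem isCP_rankOne {c : Op K} (hc : 0 ≤ c) {m : Predual L} (hm : IsPosFunctional m) :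
    IsCP (rankOne c m) := by
  intro n ρ hρ B
  simpa using sum_posSemidef_mul_nonneg (hρ.posSemidef hc) hm B

theorem IsCP.add {φ ψ : Predual K →ₗ[ℂ] Predual L} (hφ : IsCP φ) (hψ : IsCP ψ) :
    IsCP (φ + ψ) := by
  intro n ρ hρ B
  have h := add_nonneg (hφ n ρ hρ B) (hψ n ρ hρ B)
  simpa [Finset.sum_add_distrib] using h

/-- The vector functional `A ↦ (x, A x)` in the predual. -/
def vecState (x : K) : Predual K := Predual.mk (vecFun x x) (vecFun_mem x x)

@[simp]
theorem func_vecState (x : K) (A : Op K) : func (vecState x) A = inner ℂ x (A x) := rfl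

theorem norm_vecState_le (x : K) : ‖vecState x‖ ≤ ‖x‖ ^ 2 := by
  rw [← (func (K := K)).norm_map]
  refine ContinuousLinearMap.opNorm_le_bound _ (by positivity) fun A => ?_
  rw [func_vecState]
  calc ‖inner ℂ x (A x)‖ ≤ ‖x‖ * ‖A x‖ := norm_inner_le_norm _ _
    _ ≤ ‖x‖ * (‖A‖ * ‖x‖) := by gcongr; exact A.le_opNorm x
    _ = ‖x‖ ^ 2 * ‖A‖ := by ring

theorem isPosMatrix_vecState (x : K) : IsPosMatrix (n := 1) fun _ _ => vecState x := by
  intro B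
  simp only [Finset.univ_unique, Finset.sum_singleton, func_vecState]
  change 0 ≤ inner ℂ x (star (B default) (B default x))
  rw [ContinuousLinearMap.star_eq_adjoint, ContinuousLinearMap.adjoint_inner_right]
  rw [inner_self_eq_norm_sq_to_K]
  positivity

/-- The only consequence of complete positivity needed for necessary conditions is the case of size
one, tested on vector states. -/
theorem IsCP.vecState_nonneg {φ : Predual K →ₗ[ℂ] Predual L} (hφ : IsCP φ) (x : K)
    {A : Op L} (hA : 0 ≤ A) : 0 ≤ func (φ (vecState x)) A := by
  obtain ⟨B, rfl⟩ := exists_eq_star_mul_self hA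
  have h := hφ 1 _ (isPosMatrix_vecState x) fun _ => B
  simpa using h

omit [CompleteSpace K] in
theorem op_nonneg_iff {A : Op K} : 0 ≤ A ↔ ∀ x : K, 0 ≤ inner ℂ x (A x) := by
  rw [ContinuousLinearMap.nonneg_iff_isPositive, ContinuousLinearMap.isPositive_iff_complex]
  refine forall_congr' fun x => ?_
  rw [← inner_conj_symm x (A x), Complex.nonneg_iff, Complex.conj_re, Complex.conj_im,
    zero_eq_neg, Complex.ext_iff]
  simp [and_comm, eq_comm]

theorem op_ext_func {A B : Op K} (h : ∀ ρ : Predual K, func ρ A = func ρ B) : A = B := by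
  ext x
  refine ext_inner_left ℂ fun y => ?_
  exact h (Predual.mk (vecFun y x) (vecFun_mem y x))

end CompletePositivity

/-! ### Recovering a weight from its truncations; generalized representations of rank-one maps. -/

section Weights

variable {K : Type*} [NormedAddCommGroup K] [InnerProductSpace ℂ K] [CompleteSpace K]

theorem star_cutInv (t : Ioi (0 : ℝ)) : star (cutInv K t) = cutInv K t := star_mulOp _ _

theorem star_rootD : star (rootD K) = rootD K := star_mulOp _ _

theorem func_trunc (t : Ioi (0 : ℝ)) (μ : BdryWeight K) (A : Op (HalfL2 K)) :
    func (trunc t μ) A = func (normalPart μ) (cutInv K t * A * cutInv K t) := rfl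

theorem isPosFunctional_normalPart {μ : BdryWeight K} (hμ : IsPosWeight μ) :
    IsPosFunctional (normalPart μ) := by
  intro A hA
  rw [normalPart_apply]
  apply hμ
  change 0 ≤ rootD K * A * rootD K
  nth_rewrite 1 [← star_rootD]
  exact star_left_conjugate_nonneg hA _

theorem isPosFunctional_trunc {μ : BdryWeight K} (hμ : IsPosFunctional (normalPart μ))
    (t : Ioi (0 : ℝ)) : IsPosFunctional (trunc t μ) := by
  intro A hA
  rw [func_trunc]
  apply hμ
  nth_rewrite 1 [← star_cutInv]
  exact star_left_conjugate_nonneg hA _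

/-- The sequence `1 / (n + 1)` in `(0, ∞)`. -/
def invSucc (n : ℕ) : Ioi (0 : ℝ) := ⟨1 / ((n : ℝ) + 1), mem_Ioi.2 Nat.one_div_pos_of_nat⟩

/-- Truncating at `1/(n+1)` turns conjugation by `rootD` into conjugation by `cutE`, so normality
gives the limit. This is how facts about all truncations pass to the weight itself. -/
theorem tendsto_trunc (μ : BdryWeight K) (A : Op (HalfL2 K)) :
    Tendsto (fun n => func (trunc (invSucc n) μ) (rootD K * A * rootD K)) atTop
      (𝓝 (func (normalPart μ) A)) := by
  refine (tendsto_normal_cutE (func_mem (normalPart μ)) A).congr fun n => ?_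
  rw [func_trunc]
  have h1 := cutInv_mul_rootD (K := K) (invSucc n)
  have h2 := rootD_mul_cutInv (K := K) (invSucc n)
  have h3 : cutInv K (invSucc n) * (rootD K * A * rootD K) * cutInv K (invSucc n)
      = (cutInv K (invSucc n) * rootD K) * A * (rootD K * cutInv K (invSucc n)) := by
    simp only [mul_assoc]
  rw [h3, h1, h2]
  rfl

theorem isPosFunctional_normalPart_of_trunc {μ : BdryWeight K}
    (h : ∀ t, IsPosFunctional (trunc t μ)) : IsPosFunctional (normalPart μ) := by
  intro A hA
  refine ge_of_tendsto' (tendsto_trunc μ A) fun n => h _ _ ?_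
  nth_rewrite 1 [← star_rootD]
  exact star_left_conjugate_nonneg hA _

theorem bdryWeight_eq_zero {μ : BdryWeight K} (h : ∀ t, trunc t μ = 0) : μ = 0 := by
  apply Subtype.ext
  ext ⟨_, A, rfl⟩
  have h1 : func (normalPart μ) A = 0 := by
    refine tendsto_nhds_unique (tendsto_trunc μ A) ?_
    simp [h]
  rw [normalPart_apply] at h1
  exact h1

theorem exists_trunc_ne_zero {μ : BdryWeight K} (h : μ ≠ 0) : ∃ t, trunc t μ ≠ 0 := by
  by_contra! hc
  exact h (bdryWeight_eq_zero hc)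

theorem eq_zero_of_apply_one {L : Type*} [NormedAddCommGroup L] [InnerProductSpace ℂ L]
    [CompleteSpace L] {p : Predual L} (hp : IsPosFunctional p) (h : (func p 1).re ≤ 0) : p = 0 := by
  apply Predual.ext_func
  intro A
  have h1 := hp.norm_apply_le A
  have h2 : ‖func p A‖ ≤ 0 := h1.trans (mul_nonpos_of_nonpos_of_nonneg h (norm_nonneg A))
  rw [norm_le_zero_iff.1 h2]
  simp

theorem func_trunc_cut {s t : Ioi (0 : ℝ)} (h : t ≤ s) (μ : BdryWeight K) (X : Op (HalfL2 K)) :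
    func (trunc t μ) (cutE K s * X * cutE K s) = func (trunc s μ) X := by
  rw [trunc_apply, trunc_apply]
  congr 1
  apply Subtype.ext
  change cutE K t * (cutE K s * X * cutE K s) * cutE K t = cutE K s * X * cutE K s
  have h1 := cutE_mul_cutE_of_le (K := K) (show (t : ℝ) ≤ s from h)
  have h2 := cutE_mul_cutE_of_le' (K := K) (show (t : ℝ) ≤ s from h)
  rw [← mul_assoc, ← mul_assoc, h2, mul_assoc, h1]

/-- If a combination of truncations at `t` is positive, it decreases on positive operators
commuting with `E(s, ∞)` when `t` is replaced by `s ≥ t`. -/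
theorem func_trunc_anti {s t : Ioi (0 : ℝ)} (h : t ≤ s) {μ : BdryWeight K}
    (hμ : IsPosFunctional (trunc t μ)) {X : Op (HalfL2 K)} (hX : 0 ≤ X)
    (hc : cutE K s * X = X * cutE K s) : func (trunc s μ) X ≤ func (trunc t μ) X := by
  rw [← func_trunc_cut h, ← sub_nonneg, ← map_sub]
  exact hμ _ (sub_cut_nonneg hX _ hc)

theorem isPosFunctional_trunc_of_le {s t : Ioi (0 : ℝ)} (h : t ≤ s) {μ : BdryWeight K}
    (hμ : IsPosFunctional (trunc t μ)) : IsPosFunctional (trunc s μ) := by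
  intro A hA
  rw [← func_trunc_cut h]
  apply hμ
  nth_rewrite 1 [← star_cutE]
  exact star_left_conjugate_nonneg hA _

theorem func_lamHat (p : Predual (HalfL2 K)) (A : Op K) : func (lamHat p) A = func p (lam A) := rfl

theorem onePlus_apply (ω : BdryWeightMap K) (t : Ioi (0 : ℝ)) (ρ : Predual K) :
    onePlus ω t ρ = ρ + lamHat (trunc t (ω ρ)) := rfl

theorem genRep_eq {ω : BdryWeightMap K} {t : Ioi (0 : ℝ)} (hu : IsUnit (onePlus ω t))
    {φ : Predual K →ₗ[ℂ] Predual (HalfL2 K)} (h : ∀ ρ, φ (onePlus ω t ρ) = trunc t (ω ρ)) :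
    genRep ω t = φ := by
  ext1 σ
  have h1 : onePlus ω t (Ring.inverse (onePlus ω t) σ) = σ := by
    have := Ring.mul_inverse_cancel _ hu
    exact DFunLike.congr_fun this σ
  change trunc t (ω (Ring.inverse (onePlus ω t) σ)) = φ σ
  rw [← h, h1]

theorem rankOneMap_apply (e : Op K) (θ : BdryWeight K) (ρ : Predual K) :
    rankOneMap e θ ρ = func ρ e • θ := rfl

theorem isCPWeightMap_rankOneMap {e : Op K} (he : 0 ≤ e) {θ : BdryWeight K}
    (hθ : IsPosFunctional (normalPart θ)) : IsCPWeightMap (rankOneMap e θ) := by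
  intro n ρ hρ B
  have h := sum_posSemidef_mul_nonneg (hρ.posSemidef he) hθ B
  simp only [normalPart_apply, Matrix.of_apply] at h
  exact h

theorem one_add_ne_zero {b : ℂ} (hb : 0 ≤ b) : 1 + b ≠ 0 := by
  intro h
  have := congrArg Complex.re h
  have h2 := (Complex.nonneg_iff.1 hb).1
  simp at this
  linarith

/-- The Sherman–Morrison formula for the inverse of a rank-one perturbation of the identity. -/
theorem isUnit_of_apply_eq_add_smul {V : Type*} [AddCommGroup V] [Module ℂ V]
    {T : Module.End ℂ V} (f : V →ₗ[ℂ] ℂ) (v : V) (hT : ∀ ρ, T ρ = ρ + f ρ • v)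
    (hv : 1 + f v ≠ 0) : IsUnit T := by
  rw [isUnit_iff_exists]
  refine ⟨1 - (1 + f v)⁻¹ • f.smulRight v, ?_, ?_⟩
  · ext1 ρ
    change T (ρ - (1 + f v)⁻¹ • f ρ • v) = ρ
    rw [hT, map_sub, map_smul, map_smul, smul_eq_mul, smul_eq_mul]
    match_scalars
    · simp
    · field_simp
      ring
  · ext1 ρ
    change T ρ - (1 + f v)⁻¹ • f (T ρ) • v = ρ
    rw [hT, map_add, map_smul, smul_eq_mul]
    match_scalars
    · simp
    · field_simp
      ring

theorem isUnit_onePlus_rankOneMap {e : Op K} {θ : BdryWeight K} {t : Ioi (0 : ℝ)}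
    (hb : 0 ≤ func (trunc t θ) (lam e)) : IsUnit (onePlus (rankOneMap e θ) t) := by
  have hb' := one_add_ne_zero hb
  have hform (ρ : Predual K) : onePlus (rankOneMap e θ) t ρ
      = ρ + func ρ e • lamHat (trunc t θ) := by
    rw [onePlus_apply, rankOneMap_apply, map_smul, map_smul]
  exact isUnit_of_apply_eq_add_smul ((ContinuousLinearMap.apply ℂ ℂ e).toLinearMap.comp
    (func (K := K)).toLinearMap) (lamHat (trunc t θ)) hform hb'

theorem genRep_rankOneMap {e : Op K} {θ : BdryWeight K} {t : Ioi (0 : ℝ)}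
    (hb : 0 ≤ func (trunc t θ) (lam e)) :
    genRep (rankOneMap e θ) t = rankOne e ((1 + func (trunc t θ) (lam e))⁻¹ • trunc t θ) := by
  apply genRep_eq (isUnit_onePlus_rankOneMap hb)
  intro ρ
  have hb' := one_add_ne_zero hb
  rw [onePlus_apply, rankOneMap_apply, map_smul, map_smul, rankOne_apply, func_add_apply,
    func_smul_apply, func_lamHat, smul_smul]
  congr 1
  field_simp

end Weights

/-! ### Square pairs: positivity and contractivity read off coefficientwise. -/

section SquarePair

variable {K L : Type*} [NormedAddCommGroup K] [InnerProductSpace ℂ K] [CompleteSpace K]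
  [NormedAddCommGroup L] [InnerProductSpace ℂ L] [CompleteSpace L]

/-- Positive operators `e₁, e₂` such that `0 ≤ x₁ e₁ + x₂ e₂ ≤ 1` exactly for `x₁, x₂ ∈ [0, 1]`. -/
structure IsSquarePair (e₁ e₂ : Op K) : Prop where
  nonneg_left : 0 ≤ e₁
  nonneg_right : 0 ≤ e₂
  iff_mem : ∀ x₁ x₂ : ℝ,
    (0 ≤ (x₁ : ℂ) • e₁ + (x₂ : ℂ) • e₂ ∧ (x₁ : ℂ) • e₁ + (x₂ : ℂ) • e₂ ≤ 1) ↔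
      (x₁ ∈ Icc (0 : ℝ) 1 ∧ x₂ ∈ Icc (0 : ℝ) 1)

namespace IsSquarePair

variable {e₁ e₂ : Op K} (h : IsSquarePair e₁ e₂)
include h

omit [CompleteSpace K] in
theorem symm : IsSquarePair e₂ e₁ :=
  ⟨h.nonneg_right, h.nonneg_left, fun x₁ x₂ => by rw [add_comm, h.iff_mem x₂ x₁, and_comm]⟩

omit [CompleteSpace K] in
theorem add_le_one : e₁ + e₂ ≤ 1 := by
  have := ((h.iff_mem 1 1).2 (by simp)).2
  simpa using this

omit [CompleteSpace K] in
theorem left_le_one : e₁ ≤ 1 := by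
  have := ((h.iff_mem 1 0).2 (by simp)).2
  simpa using this

theorem norm_left_le_one : ‖e₁‖ ≤ 1 :=
  (CStarAlgebra.norm_le_one_iff_of_nonneg e₁ h.nonneg_left).2 h.left_le_one

/-- Scaling by `(‖B‖ + 1)⁻¹` puts the positive combination `B` below `I`, where the square condition
applies. -/
theorem coeff_nonneg {x₁ x₂ : ℝ} (hx : 0 ≤ (x₁ : ℂ) • e₁ + (x₂ : ℂ) • e₂) : 0 ≤ x₁ ∧ 0 ≤ x₂ := by
  set B := (x₁ : ℂ) • e₁ + (x₂ : ℂ) • e₂ with hB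
  set r : ℝ := (‖B‖ + 1)⁻¹ with hr
  have hr0 : 0 < r := by positivity
  have hsmul : ((r * x₁ : ℝ) : ℂ) • e₁ + ((r * x₂ : ℝ) : ℂ) • e₂ = (r : ℂ) • B := by
    rw [hB, smul_add, smul_smul, smul_smul]
    push_cast
    rfl
  have h0 : 0 ≤ (r : ℂ) • B := ofReal_smul_nonneg hr0.le hx
  have h1 : (r : ℂ) • B ≤ 1 := by
    apply (CStarAlgebra.norm_le_one_iff_of_nonneg _ h0).1
    rw [norm_smul, Complex.norm_real, Real.norm_of_nonneg hr0.le, hr, inv_mul_le_iff₀ (by positivity)]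
    linarith
  have h2 := (h.iff_mem (r * x₁) (r * x₂)).1 (by rw [hsmul]; exact ⟨h0, h1⟩)
  exact ⟨nonneg_of_mul_nonneg_right h2.1.1 hr0, nonneg_of_mul_nonneg_right h2.2.1 hr0⟩

theorem lam_right_le : lam e₂ ≤ 1 - lam e₁ := by
  rw [le_sub_iff_add_le', ← map_add]
  exact (lam_mono h.add_le_one).trans lam_one_le

end IsSquarePair

/-- The functional is real on positive operators. -/
def IsRealFunctional (p : Predual K) : Prop := ∀ A : Op K, 0 ≤ A → (func p A).im = 0

theorem IsPosFunctional.isReal {p : Predual K} (hp : IsPosFunctional p) : IsRealFunctional p :=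
  fun A hA => (Complex.nonneg_iff.1 (hp A hA)).2.symm

theorem IsPosFunctional.re_nonneg {p : Predual K} (hp : IsPosFunctional p) {A : Op K}
    (hA : 0 ≤ A) : 0 ≤ (func p A).re := (Complex.nonneg_iff.1 (hp A hA)).1

theorem IsPosFunctional.re_mono {p : Predual K} (hp : IsPosFunctional p) {A B : Op K}
    (h : A ≤ B) : (func p A).re ≤ (func p B).re := (Complex.le_def.1 (hp.mono h)).1

theorem IsRealFunctional.ofReal_re {p : Predual K} (hp : IsRealFunctional p) {A : Op K}
    (hA : 0 ≤ A) : (((func p A).re : ℝ) : ℂ) = func p A :=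
  Complex.ext (by simp) (by simp [hp A hA])

theorem IsRealFunctional.isPos {p : Predual K} (hp : IsRealFunctional p)
    (h : ∀ A, 0 ≤ A → 0 ≤ (func p A).re) : IsPosFunctional p :=
  fun A hA => Complex.nonneg_iff.2 ⟨h A hA, (hp A hA).symm⟩

theorem IsRealFunctional.sub {p q : Predual K} (hp : IsRealFunctional p) (hq : IsRealFunctional q) :
    IsRealFunctional (p - q) := fun A hA => by
  rw [func_sub_apply, Complex.sub_im, hp A hA, hq A hA, sub_zero]

theorem re_func_smul (r : ℝ) (p : Predual K) (A : Op K) :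
    (func ((r : ℂ) • p) A).re = r * (func p A).re := by
  rw [func_smul_apply, Complex.re_ofReal_mul]

theorem re_func_sub_smul (r : ℝ) (p q : Predual K) (A : Op K) :
    (func (p - (r : ℂ) • q) A).re = (func p A).re - r * (func q A).re := by
  rw [func_sub_apply, Complex.sub_re, re_func_smul]

theorem IsRealFunctional.smul {p : Predual K} (hp : IsRealFunctional p) (r : ℝ) :
    IsRealFunctional ((r : ℂ) • p) := fun A hA => by
  rw [func_smul_apply, Complex.im_ofReal_mul, hp A hA, mul_zero]

theorem IsPosFunctional.smul {p : Predual K} (hp : IsPosFunctional p) {r : ℝ} (hr : 0 ≤ r) :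
    IsPosFunctional ((r : ℂ) • p) :=
  (hp.isReal.smul r).isPos fun A hA => by
    rw [re_func_smul]
    exact mul_nonneg hr (hp.re_nonneg hA)

theorem func_rankOne_add (e₁ e₂ : Op K) (m₁ m₂ : Predual L) (A : Op L) (x : K) {x₁ x₂ : ℂ}
    (h₁ : x₁ = func m₁ A) (h₂ : x₂ = func m₂ A) :
    inner ℂ x ((x₁ • e₁ + x₂ • e₂) x)
      = func ((rankOne e₁ m₁ + rankOne e₂ m₂) (vecState x)) A := by
  subst h₁ h₂
  rw [LinearMap.add_apply, rankOne_apply, rankOne_apply, func_add_apply, func_smul_apply,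
    func_smul_apply, func_vecState, func_vecState, add_apply,
    smul_apply, smul_apply, inner_add_right,
    inner_smul_right, inner_smul_right, mul_comm (inner ℂ x (e₁ x)), mul_comm (inner ℂ x (e₂ x))]

namespace IsSquarePair

variable {e₁ e₂ : Op K} (h : IsSquarePair e₁ e₂) {m₁ m₂ : Predual L}
include h

/-- For `A ≥ 0`, testing on vector states shows that `m₁(A) e₁ + m₂(A) e₂ ≥ 0`; the square condition
then gives both signs. -/
theorem isPosFunctional_of_isCP (hr₁ : IsRealFunctional m₁) (hr₂ : IsRealFunctional m₂)
    (hcp : IsCP (rankOne e₁ m₁ + rankOne e₂ m₂)) : IsPosFunctional m₁ ∧ IsPosFunctional m₂ := by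
  have key : ∀ A, 0 ≤ A → 0 ≤ (func m₁ A).re ∧ 0 ≤ (func m₂ A).re := by
    intro A hA
    apply h.coeff_nonneg
    rw [op_nonneg_iff]
    intro x
    rw [func_rankOne_add e₁ e₂ m₁ m₂ A x (hr₁.ofReal_re hA) (hr₂.ofReal_re hA)]
    exact hcp.vecState_nonneg x hA
  exact ⟨hr₁.isPos fun A hA => (key A hA).1, hr₂.isPos fun A hA => (key A hA).2⟩

/-- Contractivity on vector states bounds `m₁(I) e₁ + m₂(I) e₂` by `I`, and the square condition
bounds each coefficient. -/
theorem apply_one_le_of_contraction (hr₁ : IsRealFunctional m₁) (hr₂ : IsRealFunctional m₂)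
    (hcp : IsCP (rankOne e₁ m₁ + rankOne e₂ m₂))
    (hc : ∀ ρ, ‖(rankOne e₁ m₁ + rankOne e₂ m₂) ρ‖ ≤ ‖ρ‖) :
    (func m₁ 1).re ≤ 1 ∧ (func m₂ 1).re ≤ 1 := by
  have hval (x : K) := func_rankOne_add e₁ e₂ m₁ m₂ 1 x (hr₁.ofReal_re zero_le_one)
    (hr₂.ofReal_re zero_le_one)
  have h1 : ∀ x, 0 ≤ func ((rankOne e₁ m₁ + rankOne e₂ m₂) (vecState x)) 1 :=
    fun x => hcp.vecState_nonneg x zero_le_one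
  have h2 := (h.iff_mem (func m₁ 1).re (func m₂ 1).re).1 ⟨?_, ?_⟩
  · exact ⟨h2.1.2, h2.2.2⟩
  · rw [op_nonneg_iff]
    intro x
    rw [hval]
    exact h1 x
  · rw [← sub_nonneg, op_nonneg_iff]
    intro x
    rw [sub_apply, inner_sub_right, hval, sub_nonneg]
    have h3 := h1 x
    have h4 : ‖func ((rankOne e₁ m₁ + rankOne e₂ m₂) (vecState x)) 1‖ ≤ ‖x‖ ^ 2 := by
      refine ((func (K := L) _).le_opNorm (1 : Op L)).trans ?_
      refine (mul_le_of_le_one_right (norm_nonneg _) ContinuousLinearMap.norm_id_le).trans ?_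
      rw [(func (K := L)).norm_map]
      exact (hc _).trans (norm_vecState_le x)
    generalize func ((rankOne e₁ m₁ + rankOne e₂ m₂) (vecState x)) 1 = z at h3 h4
    have h5 : inner ℂ x ((1 : Op K) x) = ((‖x‖ ^ 2 : ℝ) : ℂ) := by
      rw [one_apply_eq_self, inner_self_eq_norm_sq_to_K]
      simp
    rw [h5, Complex.eq_coe_norm_of_nonneg h3]
    exact_mod_cast h4

end IsSquarePair

theorem norm_rankOne_le {e : Op K} (he : ‖e‖ ≤ 1) {m : Predual L} (hm : IsPosFunctional m)
    (h1 : (func m 1).re ≤ 1) (ρ : Predual K) : ‖rankOne e m ρ‖ ≤ ‖ρ‖ := by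
  have h2 : ‖m‖ ≤ 1 := by
    rw [← (func (K := L)).norm_map]
    refine ContinuousLinearMap.opNorm_le_bound _ zero_le_one fun A => ?_
    exact (hm.norm_apply_le A).trans (mul_le_mul_of_nonneg_right h1 (norm_nonneg A))
  have h3 : ‖func ρ e‖ ≤ ‖ρ‖ := by
    refine ((func ρ).le_opNorm e).trans ?_
    rw [(func (K := K)).norm_map]
    exact mul_le_of_le_one_right (norm_nonneg _) he
  rw [rankOne_apply, norm_smul]
  exact (mul_le_of_le_one_right (norm_nonneg _) h2).trans h3

end SquarePair

/-! ### The explicit form of `π̂_t`, monotonicity of `h`, and positivity of `μ₁ - κ₁ μ₂`. -/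

section TwoWeights

variable {K : Type*} [NormedAddCommGroup K] [InnerProductSpace ℂ K] [CompleteSpace K]

/-- A `q`-weight map of the form `ρ ↦ ρ(e₁) μ₁ + ρ(e₂) μ₂` with positive `μ₁, μ₂`, for a pair
`e₁, e₂` as in `IsSquarePair`. -/
structure IsTwoWeightMap (e₁ e₂ : Op K) (μ₁ μ₂ : BdryWeight K) (ω : BdryWeightMap K) : Prop where
  pair : IsSquarePair e₁ e₂
  pos_left : IsPosWeight μ₁
  pos_right : IsPosWeight μ₂
  apply : ∀ ρ : Predual K, ω ρ = func ρ e₁ • μ₁ + func ρ e₂ • μ₂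
  isQWeightMap : IsQWeightMap ω

/-- The real number `μ(Λ(e)|_t)`. -/
def lamValue (μ : BdryWeight K) (e : Op K) (t : Ioi (0 : ℝ)) : ℝ := (func (trunc t μ) (lam e)).re

theorem hFun_eq (μ ν : BdryWeight K) (e : Op K) (t : Ioi (0 : ℝ)) :
    hFun μ ν e t = lamValue μ e t / (1 + lamValue ν e t) := by
  rw [lamValue, lamValue, trunc_apply, trunc_apply]
  rfl

theorem trunc_sub_smul (t : Ioi (0 : ℝ)) (μ ν : BdryWeight K) (c : ℂ) :
    trunc t (μ - c • ν) = trunc t μ - c • trunc t ν := by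
  rw [map_sub, map_smul]

theorem trunc_smul_add_smul (t : Ioi (0 : ℝ)) (μ ν : BdryWeight K) (c d : ℂ) :
    trunc t (c • μ + d • ν) = c • trunc t μ + d • trunc t ν := by
  rw [map_add, map_smul, map_smul]

namespace IsTwoWeightMap

variable {e₁ e₂ : Op K} {μ₁ μ₂ : BdryWeight K} {ω : BdryWeightMap K}
  (D : IsTwoWeightMap e₁ e₂ μ₁ μ₂ ω)
include D

theorem symm : IsTwoWeightMap e₂ e₁ μ₂ μ₁ ω :=
  ⟨D.pair.symm, D.pos_right, D.pos_left, fun ρ => by rw [D.apply, add_comm], D.isQWeightMap⟩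

theorem trunc_left_pos (t : Ioi (0 : ℝ)) : IsPosFunctional (trunc t μ₁) :=
  isPosFunctional_trunc (isPosFunctional_normalPart D.pos_left) t

theorem lamValue_nonneg {e : Op K} (he : 0 ≤ e) (t : Ioi (0 : ℝ)) : 0 ≤ lamValue μ₁ e t :=
  (D.trunc_left_pos t).re_nonneg (lam_nonneg he)

theorem ofReal_lamValue {e : Op K} (he : 0 ≤ e) (t : Ioi (0 : ℝ)) :
    (lamValue μ₁ e t : ℂ) = func (trunc t μ₁) (lam e) :=
  (D.trunc_left_pos t).isReal.ofReal_re (lam_nonneg he)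

theorem trunc_sub_real (t : Ioi (0 : ℝ)) (r : ℝ) :
    IsRealFunctional (trunc t (μ₁ - (r : ℂ) • μ₂)) := by
  rw [trunc_sub_smul]
  exact (D.trunc_left_pos t).isReal.sub ((D.symm.trunc_left_pos t).isReal.smul r)

theorem onePlus_eq (t : Ioi (0 : ℝ)) (ρ : Predual K) :
    onePlus ω t ρ = ρ + (func ρ e₁ • lamHat (trunc t μ₁) + func ρ e₂ • lamHat (trunc t μ₂)) := by
  rw [onePlus_apply, D.apply, map_add, map_add, map_smul, map_smul, map_smul, map_smul]

/-- The determinant of `I + Λ̂ω|_t` on the span of `e₁, e₂`. -/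
theorem det_ne_zero (t : Ioi (0 : ℝ)) :
    (1 + lamValue μ₁ e₁ t) * (1 + lamValue μ₂ e₂ t) - lamValue μ₁ e₂ t * lamValue μ₂ e₁ t ≠ 0 := by
  intro hdet
  have h11 := D.ofReal_lamValue D.pair.nonneg_left t
  have h12 := D.ofReal_lamValue D.pair.nonneg_right t
  have h21 := D.symm.ofReal_lamValue D.pair.nonneg_left t
  have h22 := D.symm.ofReal_lamValue D.pair.nonneg_right t
  have hpos := D.symm.lamValue_nonneg D.pair.nonneg_right t
  have hdet' : ((1 + lamValue μ₁ e₁ t) * (1 + lamValue μ₂ e₂ t)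
      - lamValue μ₁ e₂ t * lamValue μ₂ e₁ t : ℂ) = 0 := by exact_mod_cast hdet
  -- If the determinant vanished, this would be a kernel vector of `I + Λ̂ω|_t`; it is nonzero
  -- because its value at `e₁` would be `1 + a₂₂ > 0`.
  set ρ : Predual K := (lamValue μ₁ e₂ t : ℂ) • lamHat (trunc t μ₂)
    - (1 + lamValue μ₂ e₂ t : ℂ) • lamHat (trunc t μ₁) with hρ
  have hρ1 : func ρ e₁ = 1 + lamValue μ₂ e₂ t := by
    rw [hρ, func_sub_apply, func_smul_apply, func_smul_apply, func_lamHat, func_lamHat, ← h11, ← h21]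
    linear_combination -hdet'
  have hρ2 : func ρ e₂ = -lamValue μ₁ e₂ t := by
    rw [hρ, func_sub_apply, func_smul_apply, func_smul_apply, func_lamHat, func_lamHat, ← h12, ← h22]
    ring
  have hker : onePlus ω t ρ = 0 := by
    rw [D.onePlus_eq, hρ1, hρ2, hρ]
    module
  have hinj := ((Module.End.isUnit_iff _).1 (D.isQWeightMap.isUnit t)).1
  have hzero : ρ = 0 := hinj (by rw [hker, map_zero])
  rw [hzero] at hρ1
  have hre := congrArg Complex.re hρ1
  simp at hre
  linarith

/-- Cramer's rule; stating the formulas multiplied by `d` avoids division. -/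
theorem genRep_eq_of_det {t : Ioi (0 : ℝ)} {m₁ m₂ : Predual (HalfL2 K)} {d : ℝ}
    (hd : d = (1 + lamValue μ₁ e₁ t) * (1 + lamValue μ₂ e₂ t)
      - lamValue μ₁ e₂ t * lamValue μ₂ e₁ t)
    (h₁ : (d : ℂ) • m₁ = ((1 + lamValue μ₂ e₂ t : ℝ) : ℂ) • trunc t μ₁
      - (lamValue μ₁ e₂ t : ℂ) • trunc t μ₂)
    (h₂ : (d : ℂ) • m₂ = ((1 + lamValue μ₁ e₁ t : ℝ) : ℂ) • trunc t μ₂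
      - (lamValue μ₂ e₁ t : ℂ) • trunc t μ₁) :
    genRep ω t = rankOne e₁ m₁ + rankOne e₂ m₂ := by
  have h11 := D.ofReal_lamValue D.pair.nonneg_left t
  have h12 := D.ofReal_lamValue D.pair.nonneg_right t
  have h21 := D.symm.ofReal_lamValue D.pair.nonneg_left t
  have h22 := D.symm.ofReal_lamValue D.pair.nonneg_right t
  have hd0 : (d : ℂ) ≠ 0 := by
    rw [hd]
    exact_mod_cast D.det_ne_zero t
  apply genRep_eq (D.isQWeightMap.isUnit t)
  intro ρ
  rw [D.onePlus_eq, D.apply, trunc_smul_add_smul, LinearMap.add_apply, rankOne_apply,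
    rankOne_apply]
  simp only [func_add_apply, func_smul_apply, func_lamHat]
  rw [← h11, ← h12, ← h21, ← h22]
  apply smul_right_injective _ hd0
  simp only [smul_add, smul_comm (d : ℂ), h₁, h₂]
  rw [hd]
  push_cast
  module

/-- The functional appearing in the coefficient of `e₁` in `π̂_t`. -/
theorem exists_genRep_coeff (t : Ioi (0 : ℝ)) {d : ℝ}
    (hd : d = (1 + lamValue μ₁ e₁ t) * (1 + lamValue μ₂ e₂ t)
      - lamValue μ₁ e₂ t * lamValue μ₂ e₁ t) :
    ∃ m₁ m₂ : Predual (HalfL2 K), IsPosFunctional m₁ ∧ IsPosFunctional m₂ ∧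
      (func m₁ 1).re ≤ 1 ∧ genRep ω t = rankOne e₁ m₁ + rankOne e₂ m₂ ∧
      (d : ℂ) • m₁ = ((1 + lamValue μ₂ e₂ t : ℝ) : ℂ) • trunc t μ₁
        - (lamValue μ₁ e₂ t : ℂ) • trunc t μ₂ ∧
      (d : ℂ) • m₂ = ((1 + lamValue μ₁ e₁ t : ℝ) : ℂ) • trunc t μ₂
        - (lamValue μ₂ e₁ t : ℂ) • trunc t μ₁ := by
  have hd0 : (d : ℂ) ≠ 0 := by
    rw [hd]
    exact_mod_cast D.det_ne_zero t
  set q₁ := ((1 + lamValue μ₂ e₂ t : ℝ) : ℂ) • trunc t μ₁ - (lamValue μ₁ e₂ t : ℂ) • trunc t μ₂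
    with hq₁
  set q₂ := ((1 + lamValue μ₁ e₁ t : ℝ) : ℂ) • trunc t μ₂ - (lamValue μ₂ e₁ t : ℂ) • trunc t μ₁
    with hq₂
  have hp₁ := (D.trunc_left_pos t).isReal
  have hp₂ := (D.symm.trunc_left_pos t).isReal
  have hm₁ : (d : ℂ) • ((d⁻¹ : ℝ) : ℂ) • q₁ = q₁ := by
    rw [Complex.ofReal_inv, smul_inv_smul₀ hd0]
  have hm₂ : (d : ℂ) • ((d⁻¹ : ℝ) : ℂ) • q₂ = q₂ := by
    rw [Complex.ofReal_inv, smul_inv_smul₀ hd0]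
  have hr₁ : IsRealFunctional (((d⁻¹ : ℝ) : ℂ) • q₁) := ((hp₁.smul _).sub (hp₂.smul _)).smul _
  have hr₂ : IsRealFunctional (((d⁻¹ : ℝ) : ℂ) • q₂) := ((hp₂.smul _).sub (hp₁.smul _)).smul _
  have hgen := D.genRep_eq_of_det hd hm₁ hm₂
  have hcp := D.isQWeightMap.genRep_cp t
  have hc := D.isQWeightMap.genRep_contraction t
  rw [hgen] at hcp hc
  obtain ⟨h1, h2⟩ := D.pair.isPosFunctional_of_isCP hr₁ hr₂ hcp
  exact ⟨_, _, h1, h2, (D.pair.apply_one_le_of_contraction hr₁ hr₂ hcp hc).1, hgen, hm₁, hm₂⟩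

theorem one_add_lamValue_pos {e : Op K} (he : 0 ≤ e) (t : Ioi (0 : ℝ)) : 0 < 1 + lamValue μ₁ e t := by
  linarith [D.lamValue_nonneg he t]

/-- Evaluating the formula for `d m₁` at `Λ(e₁)` gives `d m₁(Λ(e₁)) = d - (1 + a₂₂)`. If `d < 0`,
then `m₁(Λ(e₁)) ≤ 1` makes the left side at least `d`, which is impossible. -/
theorem det_pos (t : Ioi (0 : ℝ)) :
    0 < (1 + lamValue μ₁ e₁ t) * (1 + lamValue μ₂ e₂ t)
      - lamValue μ₁ e₂ t * lamValue μ₂ e₁ t := by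
  set d := (1 + lamValue μ₁ e₁ t) * (1 + lamValue μ₂ e₂ t)
      - lamValue μ₁ e₂ t * lamValue μ₂ e₁ t with hd
  obtain ⟨m₁, m₂, hm₁, -, hle, -, h1, -⟩ := D.exists_genRep_coeff t hd
  have hd0 : d ≠ 0 := D.det_ne_zero t
  have ha := D.symm.one_add_lamValue_pos D.pair.nonneg_right t
  have h2 := congrArg (fun p => (func p (lam e₁)).re) h1
  simp only [func_sub_apply, Complex.sub_re, re_func_smul] at h2
  change _ = (1 + lamValue μ₂ e₂ t) * lamValue μ₁ e₁ t - lamValue μ₁ e₂ t * lamValue μ₂ e₁ t at h2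
  have h3 : (func m₁ (lam e₁)).re ≤ 1 :=
    (hm₁.re_mono ((lam_mono D.pair.left_le_one).trans lam_one_le)).trans hle
  by_contra hneg
  have hneg' : d < 0 := lt_of_le_of_ne (not_lt.1 hneg) hd0
  linarith [mul_le_mul_of_nonpos_left h3 hneg'.le]

theorem hFun_mul (t : Ioi (0 : ℝ)) :
    hFun μ₁ μ₂ e₂ t * (1 + lamValue μ₂ e₂ t) = lamValue μ₁ e₂ t := by
  rw [hFun_eq, div_mul_cancel₀ _ (D.symm.one_add_lamValue_pos D.pair.nonneg_right t).ne']

theorem smul_trunc_sub_hFun (t : Ioi (0 : ℝ)) :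
    ((1 + lamValue μ₂ e₂ t : ℝ) : ℂ) • trunc t (μ₁ - (hFun μ₁ μ₂ e₂ t : ℂ) • μ₂)
      = ((1 + lamValue μ₂ e₂ t : ℝ) : ℂ) • trunc t μ₁ - (lamValue μ₁ e₂ t : ℂ) • trunc t μ₂ := by
  rw [trunc_sub_smul, smul_sub, smul_smul, ← Complex.ofReal_mul, mul_comm (1 + lamValue μ₂ e₂ t),
    D.hFun_mul]

/-- `(μ₁ - h(t) μ₂)|_t` is positive, where `h(t) = μ₁(Λ(e₂)|_t) / (1 + μ₂(Λ(e₂)|_t))`. -/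
theorem trunc_sub_hFun_pos (t : Ioi (0 : ℝ)) :
    IsPosFunctional (trunc t (μ₁ - (hFun μ₁ μ₂ e₂ t : ℂ) • μ₂)) ∧
      (func (trunc t (μ₁ - (hFun μ₁ μ₂ e₂ t : ℂ) • μ₂)) (1 - lam e₁)).re ≤ 1 := by
  obtain ⟨d, hd⟩ : ∃ d, d = (1 + lamValue μ₁ e₁ t) * (1 + lamValue μ₂ e₂ t)
    - lamValue μ₁ e₂ t * lamValue μ₂ e₁ t := ⟨_, rfl⟩
  have hd0 : 0 < d := hd ▸ D.det_pos t
  obtain ⟨m₁, m₂, hm₁, -, hle, -, h1, -⟩ := D.exists_genRep_coeff t hd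
  have ha := D.symm.one_add_lamValue_pos D.pair.nonneg_right t
  have h2 : (func (trunc t (μ₁ - (hFun μ₁ μ₂ e₂ t : ℂ) • μ₂)) (lam e₁)).re
      = lamValue μ₁ e₁ t - hFun μ₁ μ₂ e₂ t * lamValue μ₂ e₁ t := by
    rw [trunc_sub_smul, re_func_sub_smul]
    rfl
  have hmul := D.hFun_mul t
  have hsm := D.smul_trunc_sub_hFun t
  rw [← h1] at hsm
  generalize trunc t (μ₁ - (hFun μ₁ μ₂ e₂ t : ℂ) • μ₂) = q at h2 hsm
  have hac : ((1 + lamValue μ₂ e₂ t : ℝ) : ℂ) ≠ 0 := by exact_mod_cast ha.ne'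
  -- The truncated difference is a positive multiple of `m₁`, so it inherits positivity.
  have hq : q = ((d / (1 + lamValue μ₂ e₂ t) : ℝ) : ℂ) • m₁ := by
    rw [Complex.ofReal_div, div_eq_inv_mul, mul_smul, ← hsm, inv_smul_smul₀ hac]
  have hc : 0 ≤ d / (1 + lamValue μ₂ e₂ t) := (div_pos hd0 ha).le
  refine ⟨hq ▸ hm₁.smul hc, ?_⟩
  rw [map_sub, Complex.sub_re, h2, hq, re_func_smul]
  have h3 : d / (1 + lamValue μ₂ e₂ t) * (func m₁ 1).re ≤ d / (1 + lamValue μ₂ e₂ t) :=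
    mul_le_of_le_one_right hc hle
  -- The factor equals `1 + q(Λ(e₁))`; thus `m₁(I) ≤ 1` becomes `q(I - Λ(e₁)) ≤ 1`.
  have h4 : d / (1 + lamValue μ₂ e₂ t)
      = 1 + lamValue μ₁ e₁ t - hFun μ₁ μ₂ e₂ t * lamValue μ₂ e₁ t := by
    rw [div_eq_iff ha.ne', hd, ← hmul]
    ring
  linarith

theorem hFun_nonneg (t : Ioi (0 : ℝ)) : 0 ≤ hFun μ₁ μ₂ e₂ t := by
  rw [hFun_eq]
  exact div_nonneg (D.lamValue_nonneg D.pair.nonneg_right t)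
    (D.symm.one_add_lamValue_pos D.pair.nonneg_right t).le

/-- By its definition `h(t)` is the value of `(μ₁ - h(t) μ₂)|_t` at `Λ(e₂)`, and `Λ(e₂) ≤ I -
Λ(e₁)`. -/
theorem hFun_le_one (t : Ioi (0 : ℝ)) : hFun μ₁ μ₂ e₂ t ≤ 1 := by
  obtain ⟨hpos, hle⟩ := D.trunc_sub_hFun_pos t
  have h1 := (hpos.re_mono D.pair.lam_right_le).trans hle
  rw [trunc_sub_smul, re_func_sub_smul] at h1
  change lamValue μ₁ e₂ t - _ * lamValue μ₂ e₂ t ≤ 1 at h1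
  linarith [D.hFun_mul t]

/-- Cutting the positive functional `(μ₁ - h(t) μ₂)|_t` further, at `s`, lowers its value at `Λ(e₂)`
from `h(t)`; solving `a₁₂(s) - h(t) a₂₂(s) ≤ h(t)` for `h(t)` gives the claim. -/
theorem hFun_anti {s t : Ioi (0 : ℝ)} (h : t ≤ s) : hFun μ₁ μ₂ e₂ s ≤ hFun μ₁ μ₂ e₂ t := by
  have h1 := (Complex.le_def.1 (func_trunc_anti h (D.trunc_sub_hFun_pos t).1
    (lam_nonneg D.pair.nonneg_right) (cutE_mul_lam _ _))).1
  rw [trunc_sub_smul, re_func_sub_smul, trunc_sub_smul, re_func_sub_smul] at h1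
  change lamValue μ₁ e₂ s - _ * lamValue μ₂ e₂ s ≤ lamValue μ₁ e₂ t - _ * lamValue μ₂ e₂ t at h1
  rw [hFun_eq μ₁ μ₂ e₂ s, div_le_iff₀ (D.symm.one_add_lamValue_pos D.pair.nonneg_right s)]
  linarith [D.hFun_mul t]

theorem isLUB_kappa : IsLUB (range (hFun μ₁ μ₂ e₂)) (kappa μ₁ μ₂ e₂) :=
  isLUB_csSup ⟨_, mem_range_self ⟨1, mem_Ioi.2 one_pos⟩⟩
    ⟨1, by rintro _ ⟨t, rfl⟩; exact D.hFun_le_one t⟩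

theorem hFun_le_kappa (t : Ioi (0 : ℝ)) : hFun μ₁ μ₂ e₂ t ≤ kappa μ₁ μ₂ e₂ :=
  D.isLUB_kappa.1 (mem_range_self t)

theorem kappa_nonneg : 0 ≤ kappa μ₁ μ₂ e₂ :=
  (D.hFun_nonneg ⟨1, mem_Ioi.2 one_pos⟩).trans (D.hFun_le_kappa _)

theorem kappa_le_one : kappa μ₁ μ₂ e₂ ≤ 1 :=
  D.isLUB_kappa.2 (by rintro _ ⟨t, rfl⟩; exact D.hFun_le_one t)

/-- For `s ≤ t`, positivity of `(μ₁ - h(s) μ₂)|_s` restricts to the truncation at `t`; for `s ≥ t`,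
`h(s) ≤ h(t)`. The inequality therefore holds with every `h(s)`, and so with their supremum. -/
theorem trunc_sub_kappa_pos (t : Ioi (0 : ℝ)) :
    IsPosFunctional (trunc t (μ₁ - (kappa μ₁ μ₂ e₂ : ℂ) • μ₂)) := by
  refine (D.trunc_sub_real t _).isPos fun A hA => ?_
  rw [trunc_sub_smul, re_func_sub_smul]
  have key (s : Ioi (0 : ℝ)) :
      hFun μ₁ μ₂ e₂ s * (func (trunc t μ₂) A).re ≤ (func (trunc t μ₁) A).re := by
    have h2 := (D.symm.trunc_left_pos t).re_nonneg hA
    have hle {s : Ioi (0 : ℝ)} (hs : s ≤ t) :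
        hFun μ₁ μ₂ e₂ s * (func (trunc t μ₂) A).re ≤ (func (trunc t μ₁) A).re := by
      have h1 := (isPosFunctional_trunc_of_le hs (D.trunc_sub_hFun_pos s).1).re_nonneg hA
      rw [trunc_sub_smul, re_func_sub_smul] at h1
      linarith
    rcases le_total s t with hs | hs
    · exact hle hs
    · exact (mul_le_mul_of_nonneg_right (D.hFun_anti hs) h2).trans (hle le_rfl)
  -- Passing to the supremum divides by `μ₂|_t(A)`, so the value zero is treated separately.
  rcases ((D.symm.trunc_left_pos t).re_nonneg hA).eq_or_lt with h0 | h0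
  · have h1 := key t
    rw [← h0] at h1 ⊢
    linarith
  · have h1 : kappa μ₁ μ₂ e₂ ≤ (func (trunc t μ₁) A).re / (func (trunc t μ₂) A).re := by
      apply D.isLUB_kappa.2
      rintro _ ⟨s, rfl⟩
      rw [le_div_iff₀ h0]
      exact key s
    rw [le_div_iff₀ h0] at h1
    linarith

/-- Replacing `h(t)` by the larger `κ₁` only lowers the value on the positive operator `I - Λ(e₁)`.
-/
theorem trunc_sub_kappa_apply_le (t : Ioi (0 : ℝ)) :
    (func (trunc t (μ₁ - (kappa μ₁ μ₂ e₂ : ℂ) • μ₂)) (1 - lam e₁)).re ≤ 1 := by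
  refine le_trans ?_ (D.trunc_sub_hFun_pos t).2
  rw [trunc_sub_smul, re_func_sub_smul, trunc_sub_smul, re_func_sub_smul]
  have h1 : 0 ≤ (func (trunc t μ₂) (1 - lam e₁)).re :=
    (D.symm.trunc_left_pos t).re_nonneg
      (sub_nonneg.2 ((lam_mono D.pair.left_le_one).trans lam_one_le))
  have h2 := mul_le_mul_of_nonneg_right (D.hFun_le_kappa t) h1
  linarith

end IsTwoWeightMap

end TwoWeights

/-! ### Rank-one `q`-weight maps and comparisons between them. -/

section Subordinates

variable {K L : Type*} [NormedAddCommGroup K] [InnerProductSpace ℂ K] [CompleteSpace K]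
  [NormedAddCommGroup L] [InnerProductSpace ℂ L] [CompleteSpace L]

theorem genRep_rankOneMap_of_pos {e : Op K} (he : 0 ≤ e) {θ : BdryWeight K} {t : Ioi (0 : ℝ)}
    (hθ : IsPosFunctional (trunc t θ)) :
    genRep (rankOneMap e θ) t = rankOne e ((((1 + lamValue θ e t)⁻¹ : ℝ) : ℂ) • trunc t θ) := by
  rw [genRep_rankOneMap (hθ _ (lam_nonneg he)), ← hθ.isReal.ofReal_re (lam_nonneg he),
    Complex.ofReal_inv, Complex.ofReal_add, Complex.ofReal_one]
  rfl

theorem lamValue_nonneg_of_pos {e : Op K} (he : 0 ≤ e) {θ : BdryWeight K} {t : Ioi (0 : ℝ)}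
    (hθ : IsPosFunctional (trunc t θ)) : 0 ≤ lamValue θ e t := hθ.re_nonneg (lam_nonneg he)

/-- The coefficient of `e` in the representation is `θ|_t / (1 + θ(Λ(e)|_t))`; its value at `I` is
at most one exactly when `hle` holds. -/
theorem isQWeightMap_rankOneMap {e : Op K} (he : 0 ≤ e) (he1 : ‖e‖ ≤ 1) {θ : BdryWeight K}
    (hθ : ∀ t, IsPosFunctional (trunc t θ))
    (hle : ∀ t, (func (trunc t θ) (1 - lam e)).re ≤ 1)
    (hn : ∀ ρ : Predual K, IsPosFunctional ρ → (rankOneMap e θ ρ).1 oneSubLam ≤ func ρ 1) :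
    IsQWeightMap (rankOneMap e θ) where
  cp := isCPWeightMap_rankOneMap he (isPosFunctional_normalPart_of_trunc hθ)
  normalized := hn
  isUnit t := isUnit_onePlus_rankOneMap (hθ t _ (lam_nonneg he))
  genRep_cp t := by
    have hb := lamValue_nonneg_of_pos he (hθ t)
    rw [genRep_rankOneMap_of_pos he (hθ t)]
    exact isCP_rankOne he ((hθ t).smul (by positivity))
  genRep_contraction t := by
    have hb := lamValue_nonneg_of_pos he (hθ t)
    rw [genRep_rankOneMap_of_pos he (hθ t)]
    refine norm_rankOne_le he1 ((hθ t).smul (by positivity)) ?_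
    have h1 := hle t
    rw [map_sub, Complex.sub_re] at h1
    change _ - lamValue θ e t ≤ 1 at h1
    rw [re_func_smul, inv_mul_le_iff₀ (by positivity)]
    linarith

theorem oneSubLam_coe_nonneg : 0 ≤ ((oneSubLam : BdryAlg K) : Op (HalfL2 K)) :=
  sub_nonneg.2 lam_one_le

theorem rankOne_sub_left (e₁ e₂ : Op K) (m₁ m₂ m : Predual L) :
    rankOne e₁ m₁ + rankOne e₂ m₂ - rankOne e₁ m = rankOne e₁ (m₁ - m) + rankOne e₂ m₂ := by
  ext1 ρ
  simp only [LinearMap.sub_apply, LinearMap.add_apply, rankOne_apply]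
  module

theorem lamValue_smul (r : ℝ) (μ : BdryWeight K) (e : Op K) (t : Ioi (0 : ℝ)) :
    lamValue ((r : ℂ) • μ) e t = r * lamValue μ e t := by
  rw [lamValue, map_smul, re_func_smul]
  rfl

theorem lamValue_smul_add (μ : BdryWeight K) (κ : ℝ) (e₁ e₂ : Op K) (t : Ioi (0 : ℝ)) :
    lamValue μ ((κ : ℂ) • e₁ + e₂) t = κ * lamValue μ e₁ t + lamValue μ e₂ t := by
  simp only [lamValue, map_add, map_smul, Complex.add_re, smul_eq_mul, Complex.re_ofReal_mul]

theorem genRep_rankOneMap_smul {T : Op K} (hT : 0 ≤ T) {μ : BdryWeight K} {t : Ioi (0 : ℝ)}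
    (hμ : IsPosFunctional (trunc t μ)) {r : ℝ} (hr : 0 ≤ r) :
    genRep (rankOneMap T ((r : ℂ) • μ)) t
      = rankOne T ((((1 + r * lamValue μ T t)⁻¹ * r : ℝ) : ℂ) • trunc t μ) := by
  have hp : IsPosFunctional (trunc t ((r : ℂ) • μ)) := by
    rw [map_smul]
    exact hμ.smul hr
  rw [genRep_rankOneMap_of_pos hT hp, lamValue_smul, map_smul, smul_smul, ← Complex.ofReal_mul]

/-- Halving the weight of a `q`-weight map `ρ ↦ ρ(T) μ` gives a `q`-subordinate. -/
theorem isQSubordinate_half {T : Op K} (hT : 0 ≤ T) {μ : BdryWeight K} (hμ : IsPosWeight μ)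
    (hq : IsQWeightMap (rankOneMap T μ)) :
    IsQSubordinate (rankOneMap T (((1 / 2 : ℝ) : ℂ) • μ)) (rankOneMap T μ) := by
  have hp (t : Ioi (0 : ℝ)) : IsPosFunctional (trunc t μ) :=
    isPosFunctional_trunc (isPosFunctional_normalPart hμ) t
  have hp' (t : Ioi (0 : ℝ)) : IsPosFunctional (trunc t (((1 / 2 : ℝ) : ℂ) • μ)) := by
    rw [map_smul]
    exact (hp t).smul (by norm_num)
  have hb (t : Ioi (0 : ℝ)) := lamValue_nonneg_of_pos hT (hp t)
  have hgen (t : Ioi (0 : ℝ)) := genRep_rankOneMap_of_pos hT (hp t)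
  have hgen' (t : Ioi (0 : ℝ)) : genRep (rankOneMap T (((1 / 2 : ℝ) : ℂ) • μ)) t
      = rankOne T ((((2 + lamValue μ T t)⁻¹ : ℝ) : ℂ) • trunc t μ) := by
    have hb := hb t
    have h1 : (1 + 1 / 2 * lamValue μ T t)⁻¹ * (1 / 2) = (2 + lamValue μ T t)⁻¹ := by
      field_simp
    rw [genRep_rankOneMap_smul hT (hp t) (by norm_num), h1]
  refine ⟨⟨?_, ?_, ?_, ?_, ?_⟩, hq, ?_⟩
  · exact isCPWeightMap_rankOneMap hT (isPosFunctional_normalPart_of_trunc hp')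
  · intro ρ hρ
    have h1 := hq.normalized ρ hρ
    have h2 : (rankOneMap T (((1 / 2 : ℝ) : ℂ) • μ) ρ).1 oneSubLam
        = ((1 / 2 : ℝ) : ℂ) * (rankOneMap T μ ρ).1 oneSubLam := by
      change func ρ T * (((1 / 2 : ℝ) : ℂ) * μ.1 oneSubLam) = _ * (func ρ T * μ.1 oneSubLam)
      ring
    have h3 : 0 ≤ (rankOneMap T μ ρ).1 oneSubLam :=
      mul_nonneg (hρ T hT) (hμ _ oneSubLam_coe_nonneg)
    rw [h2]
    refine le_trans (mul_le_of_le_one_left h3 ?_) h1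
    exact_mod_cast (by norm_num : (1 / 2 : ℝ) ≤ 1)
  · exact fun t => isUnit_onePlus_rankOneMap (hp' t _ (lam_nonneg hT))
  · intro t
    have hb := hb t
    rw [hgen' t]
    exact isCP_rankOne hT ((hp t).smul (by positivity))
  · intro t ρ
    have hb := hb t
    have h1 := hq.genRep_contraction t ρ
    refine le_trans ?_ h1
    rw [hgen, hgen', rankOne_apply, rankOne_apply, norm_smul, norm_smul,
      norm_smul, norm_smul, Complex.norm_real, Complex.norm_real,
      Real.norm_of_nonneg (by positivity), Real.norm_of_nonneg (by positivity)]
    gcongr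
    norm_num
  · intro t
    have hb := hb t
    have h1 : genRep (rankOneMap T μ) t - genRep (rankOneMap T (((1 / 2 : ℝ) : ℂ) • μ)) t
        = rankOne T ((((1 + lamValue μ T t)⁻¹ - (2 + lamValue μ T t)⁻¹ : ℝ) : ℂ) • trunc t μ) := by
      rw [hgen, hgen']
      ext1 ρ
      simp only [LinearMap.sub_apply, rankOne_apply, Complex.ofReal_sub]
      module
    rw [h1]
    refine isCP_rankOne hT ((hp t).smul (sub_nonneg.2 ?_))
    gcongr
    norm_num

/-- In the difference of representations `e₁` carries a negative multiple of `θ₁|_t`. Its positivity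
forces `θ₁|_t(I) ≤ 0` for each `t`. -/
theorem IsSquarePair.eq_zero_of_isQSubordinate {e₁ e₂ : Op K} (h : IsSquarePair e₁ e₂)
    {θ₁ θ₂ : BdryWeight K} (h₁ : ∀ t, IsPosFunctional (trunc t θ₁))
    (h₂ : ∀ t, IsPosFunctional (trunc t θ₂))
    (hs : IsQSubordinate (rankOneMap e₁ θ₁) (rankOneMap e₂ θ₂)) : θ₁ = 0 := by
  apply bdryWeight_eq_zero
  intro t
  have hb := lamValue_nonneg_of_pos h.nonneg_left (h₁ t)
  have hcp := hs.2.2 t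
  rw [genRep_rankOneMap_of_pos h.nonneg_left (h₁ t),
    genRep_rankOneMap_of_pos h.nonneg_right (h₂ t)] at hcp
  have heq : ∀ (c d : ℝ) (p q : Predual (HalfL2 K)),
      rankOne e₂ ((d : ℂ) • q) - rankOne e₁ ((c : ℂ) • p)
        = rankOne e₁ (((-c : ℝ) : ℂ) • p) + rankOne e₂ ((d : ℂ) • q) := by
    intro c d p q
    ext1 ρ
    simp only [LinearMap.sub_apply, LinearMap.add_apply, rankOne_apply, Complex.ofReal_neg]
    module
  rw [heq] at hcp
  have hpos := (h.isPosFunctional_of_isCP ((h₁ t).isReal.smul _) ((h₂ t).isReal.smul _) hcp).1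
  have h3 := hpos.re_nonneg zero_le_one
  rw [re_func_smul] at h3
  have h4 : 0 < (1 + lamValue θ₁ e₁ t)⁻¹ := by positivity
  exact eq_zero_of_apply_one (h₁ t) (nonpos_of_mul_nonpos_right (by linarith) h4)

theorem rankOneMap_zero (e : Op K) : rankOneMap e (0 : BdryWeight K) = 0 := by
  ext1 ρ
  rw [rankOneMap_apply, smul_zero, LinearMap.zero_apply]

theorem dualRange_rankOneMap_le (T : Op K) (μ : BdryWeight K) :
    dualRange (rankOneMap T μ) ≤ Submodule.span ℂ {T} := by
  rintro B ⟨A, hA⟩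
  rw [Submodule.mem_span_singleton]
  refine ⟨μ.1 A, op_ext_func fun ρ => ?_⟩
  rw [hA ρ, map_smul, smul_eq_mul, mul_comm]
  rfl

theorem hasRangeRank_rankOneMap {T : Op K} (hT : T ≠ 0) {μ : BdryWeight K} (hμ : μ ≠ 0) :
    HasRangeRank (rankOneMap T μ) 1 := by
  have heq : dualRange (rankOneMap T μ) = Submodule.span ℂ {T} := by
    refine le_antisymm (dualRange_rankOneMap_le T μ) ?_
    rw [Submodule.span_singleton_le_iff_mem]
    obtain ⟨A, hA⟩ : ∃ A, μ.1 A ≠ 0 := by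
      by_contra! hc
      exact hμ (Subtype.ext (LinearMap.ext hc))
    refine ⟨(μ.1 A)⁻¹ • A, fun ρ => ?_⟩
    change _ = func ρ T * μ.1 ((μ.1 A)⁻¹ • A)
    rw [map_smul, smul_eq_mul, inv_mul_cancel₀ hA, mul_one]
  rw [HasRangeRank, heq, ← Module.finrank_eq_rank, finrank_span_singleton hT]

theorem not_hasRangeRank_two_rankOneMap (T : Op K) (μ : BdryWeight K) :
    ¬ HasRangeRank (rankOneMap T μ) 2 := by
  intro h
  have h1 := Submodule.rank_mono (dualRange_rankOneMap_le T μ)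
  have h2 := h1.trans (rank_span_le _)
  rw [HasRangeRank] at h
  rw [h, Cardinal.mk_singleton] at h2
  norm_num at h2

/-- The linear algebra behind `η ≤_q ω`: removing the representation of `η` from the `e₁`
coefficient leaves a multiple of the `e₂` coefficient, with a scalar whose sign is that of `k -
h(t)` when `1 + a₂₂` and `1 + b` are positive. -/
theorem sub_inv_smul_eq {V : Type*} [AddCommGroup V] [Module ℂ V] {p₁ p₂ m₁ m₂ : V}
    {a₁₁ a₁₂ a₂₁ a₂₂ k b d : ℂ} (hd0 : d ≠ 0) (hd : d = (1 + a₁₁) * (1 + a₂₂) - a₁₂ * a₂₁)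
    (h₁ : d • m₁ = (1 + a₂₂) • p₁ - a₁₂ • p₂) (h₂ : d • m₂ = (1 + a₁₁) • p₂ - a₂₁ • p₁)
    (hb : 1 + b ≠ 0) (hbeq : b = a₁₁ - k * a₂₁) :
    m₁ - (1 + b)⁻¹ • (p₁ - k • p₂) = ((1 + b)⁻¹ * (k * (1 + a₂₂) - a₁₂)) • m₂ := by
  have h3 : (1 + b) • m₁ = p₁ - k • p₂ + (k * (1 + a₂₂) - a₁₂) • m₂ := by
    apply smul_right_injective _ hd0
    simp only
    rw [smul_comm, h₁, smul_add, smul_comm d _ m₂, h₂, hbeq, hd]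
    module
  have h4 : m₁ = (1 + b)⁻¹ • (1 + b) • m₁ := (inv_smul_smul₀ hb m₁).symm
  rw [h4, h3]
  module

theorem one_sub_mul_smul_eq_zero {V : Type*} [AddCommGroup V] [Module ℂ V] {a b : ℂ} {x : V}
    (h : x = a • b • x) : (1 - a * b) • x = 0 := by
  rw [sub_smul, one_smul, mul_smul, ← h, sub_self]

theorem rankOne_sub_rankOne_smul_add (e₁ e₂ : Op K) (κ r s : ℝ) (p : Predual L) :
    rankOne e₂ ((r : ℂ) • p) - rankOne ((κ : ℂ) • e₁ + e₂) ((s : ℂ) • p)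
      = rankOne e₁ (((-(κ * s) : ℝ) : ℂ) • p) + rankOne e₂ (((r - s : ℝ) : ℂ) • p) := by
  ext1 ρ
  simp only [LinearMap.sub_apply, LinearMap.add_apply, rankOne_apply, map_add, map_smul,
    smul_eq_mul]
  push_cast
  module

theorem rankOne_smul_add_sub_rankOne (e₁ e₂ : Op K) (κ r s : ℝ) (p : Predual L) :
    rankOne ((κ : ℂ) • e₁ + e₂) ((s : ℂ) • p) - rankOne e₂ ((r : ℂ) • p)
      = rankOne e₁ (((κ * s : ℝ) : ℂ) • p) + rankOne e₂ (((s - r : ℝ) : ℂ) • p) := by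
  ext1 ρ
  simp only [LinearMap.sub_apply, LinearMap.add_apply, rankOne_apply, map_add, map_smul,
    smul_eq_mul]
  push_cast
  module

namespace IsSquarePair

variable {e₁ e₂ : Op K} (h : IsSquarePair e₁ e₂) {μ : BdryWeight K}
  (hμ : ∀ t, IsPosFunctional (trunc t μ)) {κ r c : ℝ}
include h

theorem smul_add_nonneg (hκ : 0 ≤ κ) : 0 ≤ (κ : ℂ) • e₁ + e₂ :=
  add_nonneg (ofReal_smul_nonneg hκ h.nonneg_left) h.nonneg_right

include hμ

/-- The larger map has no `e₁` component, so the `e₁` coefficient of the difference is a strictly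
negative multiple of `μ|_t`. -/
theorem eq_zero_of_isQSubordinate_smul (hκ : 0 < κ) (hr : 0 < r) (hc : 0 ≤ c)
    (hs : IsQSubordinate (rankOneMap ((κ : ℂ) • e₁ + e₂) ((r : ℂ) • μ))
      (rankOneMap e₂ ((c : ℂ) • μ))) : μ = 0 := by
  refine bdryWeight_eq_zero fun t => ?_
  have hT := h.smul_add_nonneg hκ.le
  have hs := hs.2.2 t
  rw [genRep_rankOneMap_smul hT (hμ t) hr.le, genRep_rankOneMap_smul h.nonneg_right (hμ t) hc,
    rankOne_sub_rankOne_smul_add] at hs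
  have hpos := (h.isPosFunctional_of_isCP ((hμ t).isReal.smul _) ((hμ t).isReal.smul _) hs).1
  have h3 := hpos.re_nonneg zero_le_one
  rw [re_func_smul] at h3
  have h1 := lamValue_nonneg_of_pos hT (hμ t)
  generalize lamValue μ ((κ : ℂ) • e₁ + e₂) t = b at h1 h3
  have h4 : 0 < κ * ((1 + r * b)⁻¹ * r) := by positivity
  exact eq_zero_of_apply_one (hμ t) (nonpos_of_mul_nonpos_right (by linarith) h4)

/-- Comparison of the coefficients of `e₂`; the terms in `μ(Λ(e₂)|_t)` cancel after clearing
denominators. -/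
theorem mul_le_one_of_isQSubordinate (hμ0 : μ ≠ 0) (hκ : 0 ≤ κ) (hc : 0 ≤ c)
    (hs : IsQSubordinate (rankOneMap e₂ ((c : ℂ) • μ))
      (rankOneMap ((κ : ℂ) • e₁ + e₂) (((1 / 2 : ℝ) : ℂ) • μ))) (t : Ioi (0 : ℝ)) :
    c * (2 + κ * lamValue μ e₁ t) ≤ 1 := by
  have hT := h.smul_add_nonneg hκ
  have ha1 (t : Ioi (0 : ℝ)) := lamValue_nonneg_of_pos h.nonneg_left (hμ t)
  have key (t : Ioi (0 : ℝ)) (ht : 0 < (func (trunc t μ) 1).re) :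
      c * (2 + κ * lamValue μ e₁ t) ≤ 1 := by
    have hs := hs.2.2 t
    rw [genRep_rankOneMap_smul hT (hμ t) (by norm_num),
      genRep_rankOneMap_smul h.nonneg_right (hμ t) hc, rankOne_smul_add_sub_rankOne] at hs
    have hpos := (h.isPosFunctional_of_isCP ((hμ t).isReal.smul _) ((hμ t).isReal.smul _) hs).2
    have h3 := hpos.re_nonneg zero_le_one
    rw [re_func_smul, lamValue_smul_add] at h3
    have h1 := ha1 t
    have h2 := lamValue_nonneg_of_pos h.nonneg_right (hμ t)
    have h4 := nonneg_of_mul_nonneg_left h3 ht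
    have h5 : 0 < 1 + 1 / 2 * (κ * lamValue μ e₁ t + lamValue μ e₂ t) := by positivity
    have h6 : 0 < 1 + c * lamValue μ e₂ t := by positivity
    rw [sub_nonneg, inv_mul_eq_div, inv_mul_eq_div, div_le_div_iff₀ h6 h5] at h4
    linarith
  by_cases ht : 0 < (func (trunc t μ) 1).re
  · exact key t ht
  -- Here `μ|_t = 0`, so only `2c ≤ 1` is needed, and that follows from the bound at a `t₀` with
  -- `μ|_{t₀} ≠ 0`.
  · obtain ⟨t₀, ht₀⟩ := exists_trunc_ne_zero hμ0
    have h0 : 0 < (func (trunc t₀ μ) 1).re := by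
      by_contra hn
      exact ht₀ (eq_zero_of_apply_one (hμ t₀) (not_lt.1 hn))
    have h1 := key t₀ h0
    have h2 : lamValue μ e₁ t = 0 := by
      rw [lamValue, eq_zero_of_apply_one (hμ t) (not_lt.1 ht)]
      simp
    have h3 : 0 ≤ c * (κ * lamValue μ e₁ t₀) := mul_nonneg hc (mul_nonneg hκ (ha1 t₀))
    rw [h2]
    linarith

end IsSquarePair

/-! ### The subordinates `η` and `ν`, and the consequences of `q`-purity. -/

namespace IsTwoWeightMap

variable {e₁ e₂ : Op K} {μ₁ μ₂ : BdryWeight K} {ω : BdryWeightMap K}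
  (D : IsTwoWeightMap e₁ e₂ μ₁ μ₂ ω)
include D

omit D in
theorem lamValue_sub_smul (e : Op K) (t : Ioi (0 : ℝ)) (k : ℝ) :
    lamValue (μ₁ - (k : ℂ) • μ₂) e t = lamValue μ₁ e t - k * lamValue μ₂ e t := by
  rw [lamValue, trunc_sub_smul, re_func_sub_smul]
  rfl

theorem isQWeightMap_left :
    IsQWeightMap (rankOneMap e₁ (μ₁ - (kappa μ₁ μ₂ e₂ : ℂ) • μ₂)) := by
  refine isQWeightMap_rankOneMap D.pair.nonneg_left D.pair.norm_left_le_one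
    D.trunc_sub_kappa_pos D.trunc_sub_kappa_apply_le fun ρ hρ => ?_
  refine le_trans ?_ (D.isQWeightMap.normalized ρ hρ)
  rw [D.apply]
  change func ρ e₁ * (μ₁.1 oneSubLam - (kappa μ₁ μ₂ e₂ : ℂ) * μ₂.1 oneSubLam)
    ≤ func ρ e₁ * μ₁.1 oneSubLam + func ρ e₂ * μ₂.1 oneSubLam
  have h1 := D.pos_right _ (oneSubLam_coe_nonneg (K := K))
  have h2 : (0 : ℂ) ≤ kappa μ₁ μ₂ e₂ := by exact_mod_cast D.kappa_nonneg
  have h3 := mul_nonneg (hρ _ D.pair.nonneg_left) (mul_nonneg h2 h1)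
  have h4 := mul_nonneg (hρ _ D.pair.nonneg_right) h1
  rw [← sub_nonneg]
  -- The normalization slack is `(κ₁ ρ(e₁) + ρ(e₂)) μ₂(I - Λ(I))`.
  refine (add_nonneg h3 h4).trans_eq ?_
  ring

theorem isQSubordinate_left :
    IsQSubordinate (rankOneMap e₁ (μ₁ - (kappa μ₁ μ₂ e₂ : ℂ) • μ₂)) ω := by
  refine ⟨D.isQWeightMap_left, D.isQWeightMap, fun t => ?_⟩
  obtain ⟨d, hd⟩ : ∃ d, d = (1 + lamValue μ₁ e₁ t) * (1 + lamValue μ₂ e₂ t)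
    - lamValue μ₁ e₂ t * lamValue μ₂ e₁ t := ⟨_, rfl⟩
  have hd0 : (d : ℂ) ≠ 0 := by
    rw [hd]
    exact_mod_cast D.det_ne_zero t
  obtain ⟨m₁, m₂, -, hm₂, -, hgen, h1, h2⟩ := D.exists_genRep_coeff t hd
  have hpos := D.trunc_sub_kappa_pos t
  have hb := lamValue_nonneg_of_pos D.pair.nonneg_left hpos
  have hk := D.hFun_le_kappa t
  have hmul := D.hFun_mul t
  have ha := D.symm.one_add_lamValue_pos D.pair.nonneg_right t
  rw [genRep_rankOneMap_of_pos D.pair.nonneg_left hpos, hgen, rankOne_sub_left]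
  generalize kappa μ₁ μ₂ e₂ = k at *
  set b := lamValue (μ₁ - (k : ℂ) • μ₂) e₁ t with hbdef
  have hb1 : 0 < 1 + b := by positivity
  have hbc : ((1 + b : ℝ) : ℂ) ≠ 0 := by exact_mod_cast hb1.ne'
  have hbeq : b = lamValue μ₁ e₁ t - k * lamValue μ₂ e₁ t := lamValue_sub_smul e₁ t k
  have hcoef : m₁ - (((1 + b)⁻¹ : ℝ) : ℂ) • trunc t (μ₁ - (k : ℂ) • μ₂)
      = (((1 + b)⁻¹ * (k * (1 + lamValue μ₂ e₂ t) - lamValue μ₁ e₂ t) : ℝ) : ℂ) • m₂ := by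
    rw [trunc_sub_smul]
    push_cast at h1 h2 hbc ⊢
    exact sub_inv_smul_eq hd0 (by rw [hd]; push_cast; rfl) h1 h2 hbc (by rw [hbeq]; push_cast; rfl)
  rw [hcoef]
  -- This is `h(t) ≤ κ₁` with the denominator cleared.
  have hc : 0 ≤ k * (1 + lamValue μ₂ e₂ t) - lamValue μ₁ e₂ t := by
    have := mul_le_mul_of_nonneg_right hk ha.le
    linarith
  exact (isCP_rankOne D.pair.nonneg_left (hm₂.smul (by positivity))).add
    (isCP_rankOne D.pair.nonneg_right hm₂)

theorem not_isQSubordinate_left (h : μ₁ - (kappa μ₁ μ₂ e₂ : ℂ) • μ₂ ≠ 0) :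
    ¬ IsQSubordinate (rankOneMap e₁ (μ₁ - (kappa μ₁ μ₂ e₂ : ℂ) • μ₂))
      (rankOneMap e₂ (μ₂ - (kappa μ₂ μ₁ e₁ : ℂ) • μ₁)) := fun hs =>
  h (D.pair.eq_zero_of_isQSubordinate D.trunc_sub_kappa_pos D.symm.trunc_sub_kappa_pos hs)

/-- Proportional weights collapse `ω` to rank one; this serves both the range-rank statements and
the analysis of `q`-purity. -/
theorem eq_rankOneMap {κ : ℂ} (h : μ₁ = κ • μ₂) : ω = rankOneMap (κ • e₁ + e₂) μ₂ := by
  ext1 ρ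
  rw [D.apply, rankOneMap_apply, h, map_add, map_smul, smul_eq_mul]
  module

theorem sub_kappa_ne_zero_of_hasRangeRank_two (hr : HasRangeRank ω 2) :
    μ₁ - (kappa μ₁ μ₂ e₂ : ℂ) • μ₂ ≠ 0 := by
  intro h
  rw [D.eq_rankOneMap (sub_eq_zero.1 h)] at hr
  exact not_hasRangeRank_two_rankOneMap _ _ hr

/-- If `ω` is `q`-pure and `μ₁ = κ₁ μ₂`, then also `μ₂ = κ₂ μ₁`: otherwise `ω / 2` and
`ρ ↦ ρ(e₂) (μ₂ - κ₂ μ₁)` are incomparable `q`-subordinates. -/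
theorem sub_kappa_eq_zero_of_isQPure (hpure : IsQPure ω) (hne : μ₁ ≠ 0)
    (h : μ₁ - (kappa μ₁ μ₂ e₂ : ℂ) • μ₂ = 0) : μ₂ - (kappa μ₂ μ₁ e₁ : ℂ) • μ₁ = 0 := by
  by_contra hν
  set κ := kappa μ₁ μ₂ e₂ with hκ
  set κ' := kappa μ₂ μ₁ e₁ with hκ'
  have hκ0 : 0 ≤ κ := D.kappa_nonneg
  have hμ := sub_eq_zero.1 h
  have hκpos : 0 < κ := by
    refine lt_of_le_of_ne hκ0 fun h0 => hne ?_
    rw [hμ, ← h0, Complex.ofReal_zero, zero_smul]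
  have hμ₂ : μ₂ ≠ 0 := fun h0 => hne (by rw [hμ, h0, smul_zero])
  obtain ⟨c, hc⟩ : ∃ c, c = 1 - κ * κ' := ⟨_, rfl⟩
  have hc0 : 0 ≤ c := by
    have := mul_le_one₀ D.kappa_le_one D.symm.kappa_nonneg D.symm.kappa_le_one
    linarith
  have hθ : μ₂ - (κ' : ℂ) • μ₁ = (c : ℂ) • μ₂ := by
    rw [hμ, hc]
    push_cast
    module
  have hcne : c ≠ 0 := by
    rintro h0
    exact hν (by rw [hθ, h0, Complex.ofReal_zero, zero_smul])
  have hcpos := lt_of_le_of_ne hc0 hcne.symm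
  have hω := D.eq_rankOneMap hμ
  have hhalf := isQSubordinate_half (D.pair.smul_add_nonneg hκ0) D.pos_right (hω ▸ D.isQWeightMap)
  have hν' := D.symm.isQSubordinate_left
  rw [← hκ', hθ] at hν'
  rw [← hω] at hhalf
  rcases hpure.2 _ _ hhalf hν' with hs | hs
  · exact hμ₂ (D.pair.eq_zero_of_isQSubordinate_smul D.symm.trunc_left_pos hκpos (by norm_num) hc0 hs)
  · have hbound := D.pair.mul_le_one_of_isQSubordinate D.symm.trunc_left_pos hμ₂ hκ0 hc0 hs
    have ha1 := D.symm.lamValue_nonneg D.pair.nonneg_left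
    have hc1 : 0 < 1 - c := by
      have h1 := hbound ⟨1, mem_Ioi.2 one_pos⟩
      have h2 := mul_nonneg hc0 (mul_nonneg hκ0 (ha1 ⟨1, mem_Ioi.2 one_pos⟩))
      linarith
    -- Since `μ₁ = κ μ₂`, here `h(t) = a / (1 + κ a)` with `a = μ₂(Λ(e₁)|_t)`, and this bound is
    -- equivalent to `c (2 + κ a) ≤ 1`.
    have hle : κ' ≤ (1 - 2 * c) / ((1 - c) * κ) := by
      apply D.symm.isLUB_kappa.2
      rintro _ ⟨t, rfl⟩
      have h1 := hbound t
      have h2 := ha1 t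
      have h3 : lamValue μ₁ e₁ t = κ * lamValue μ₂ e₁ t := by
        conv_lhs => rw [hμ, lamValue_smul]
      have h4 : 0 < 1 + κ * lamValue μ₂ e₁ t := by positivity
      rw [hFun_eq, h3, div_le_div_iff₀ h4 (by positivity)]
      linarith
    rw [le_div_iff₀ (by positivity)] at hle
    -- Substituting `κ κ' = 1 - c` turns the bound on `κ'` into `c² ≤ 0`.
    have h5 : (1 - c) * (1 - c) ≤ 1 - 2 * c := by
      have : κ' * ((1 - c) * κ) = (1 - c) * (1 - c) := by
        rw [show κ' * ((1 - c) * κ) = (1 - c) * (κ * κ') by ring, show κ * κ' = 1 - c by linarith]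
      linarith
    linarith [mul_pos hcpos hcpos]

/-- If `ω` is `q`-pure then `μ₁ = μ₂`. -/
theorem eq_of_isQPure (hpure : IsQPure ω) (h₁ : μ₁ ≠ 0) (h₂ : μ₂ ≠ 0) : μ₁ = μ₂ := by
  have key : μ₁ - (kappa μ₁ μ₂ e₂ : ℂ) • μ₂ = 0 ∧ μ₂ - (kappa μ₂ μ₁ e₁ : ℂ) • μ₁ = 0 := by
    by_cases h : μ₁ - (kappa μ₁ μ₂ e₂ : ℂ) • μ₂ = 0
    · exact ⟨h, D.sub_kappa_eq_zero_of_isQPure hpure h₁ h⟩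
    by_cases h' : μ₂ - (kappa μ₂ μ₁ e₁ : ℂ) • μ₁ = 0
    · exact ⟨D.symm.sub_kappa_eq_zero_of_isQPure hpure h₂ h', h'⟩
    exact absurd (hpure.2 _ _ D.isQSubordinate_left D.symm.isQSubordinate_left)
      (not_or.2 ⟨D.not_isQSubordinate_left h, D.symm.not_isQSubordinate_left h'⟩)
  obtain ⟨ha, hb⟩ := key
  have ha := sub_eq_zero.1 ha
  have hb := sub_eq_zero.1 hb
  have h3 : ((1 - kappa μ₁ μ₂ e₂ * kappa μ₂ μ₁ e₁ : ℝ) : ℂ) • μ₁ = 0 := by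
    have h4 : μ₁ = (kappa μ₁ μ₂ e₂ : ℂ) • (kappa μ₂ μ₁ e₁ : ℂ) • μ₁ := by rw [← hb, ← ha]
    push_cast
    exact one_sub_mul_smul_eq_zero (V := BdryWeight K) h4
  have h5 : 1 - kappa μ₁ μ₂ e₂ * kappa μ₂ μ₁ e₁ = 0 := by
    exact_mod_cast (smul_eq_zero.1 h3).resolve_right h₁
  have h6 := D.kappa_le_one
  have h7 := D.symm.kappa_le_one
  have h8 : kappa μ₁ μ₂ e₂ = 1 := by
    linarith [mul_le_of_le_one_right D.kappa_nonneg h7]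
  rw [ha, h8, Complex.ofReal_one, one_smul]

theorem hasRangeRank_one_of_eq (h₂ : μ₂ ≠ 0) (h : μ₁ = μ₂) : HasRangeRank ω 1 := by
  rw [D.eq_rankOneMap (κ := 1) (by rw [one_smul, h])]
  refine hasRangeRank_rankOneMap (fun h0 => ?_) h₂
  -- If `e₁ + e₂` were zero, the combination with both coefficients `-1` would be positive.
  have := (D.pair.coeff_nonneg (x₁ := -1) (x₂ := -1) (by
    push_cast
    rw [← smul_add, ← one_smul ℂ e₁, h0, smul_zero])).1
  linarith

end IsTwoWeightMap

end Subordinates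

end

end QWeight

/-! ### Assembly of the theorem. -/

theorem mainTheorem9 {K : Type*} [NormedAddCommGroup K] [InnerProductSpace ℂ K] [CompleteSpace K]
    [TopologicalSpace.SeparableSpace K]
    (e₁ e₂ : QWeight.Op K) (he₁ : 0 ≤ e₁) (he₂ : 0 ≤ e₂)
    (hsq : ∀ x₁ x₂ : ℝ,
      (0 ≤ (x₁ : ℂ) • e₁ + (x₂ : ℂ) • e₂ ∧ (x₁ : ℂ) • e₁ + (x₂ : ℂ) • e₂ ≤ 1) ↔
        (x₁ ∈ Set.Icc (0 : ℝ) 1 ∧ x₂ ∈ Set.Icc (0 : ℝ) 1))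
    (μ₁ μ₂ : QWeight.BdryWeight K) (hμ₁ : QWeight.IsPosWeight μ₁) (hμ₂ : QWeight.IsPosWeight μ₂)
    (ω : QWeight.BdryWeightMap K)
    (hω : ∀ ρ : QWeight.Predual K, ω ρ =
      QWeight.func ρ e₁ • μ₁ + QWeight.func ρ e₂ • μ₂)
    (hq : QWeight.IsQWeightMap ω)
    (κ₁ κ₂ : ℝ) (hκ₁ : κ₁ = QWeight.kappa μ₁ μ₂ e₂) (hκ₂ : κ₂ = QWeight.kappa μ₂ μ₁ e₁)
    (η ν : QWeight.BdryWeightMap K)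
    (hη : η = QWeight.rankOneMap e₁ (μ₁ - (κ₁ : ℂ) • μ₂))
    (hν : ν = QWeight.rankOneMap e₂ (μ₂ - (κ₂ : ℂ) • μ₁)) :
    (μ₁ ≠ 0 → μ₂ ≠ 0 → QWeight.IsQPure ω → μ₁ = μ₂ ∧ QWeight.HasRangeRank ω 1) ∧
    IsLUB (Set.range (QWeight.hFun μ₁ μ₂ e₂)) κ₁ ∧
    IsLUB (Set.range (QWeight.hFun μ₂ μ₁ e₁)) κ₂ ∧
    QWeight.IsQSubordinate η ω ∧ QWeight.IsQSubordinate ν ω ∧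
    (η ≠ 0 → ν ≠ 0 → ¬ QWeight.IsQSubordinate η ν ∧ ¬ QWeight.IsQSubordinate ν η) ∧
    (QWeight.HasRangeRank ω 2 →
      ¬ QWeight.IsQSubordinate η ν ∧ ¬ QWeight.IsQSubordinate ν η) := by
  have D : QWeight.IsTwoWeightMap e₁ e₂ μ₁ μ₂ ω := ⟨⟨he₁, he₂, hsq⟩, hμ₁, hμ₂, hω, hq⟩
  subst hη hν hκ₁ hκ₂
  refine ⟨fun h₁ h₂ hpure => ?_, D.isLUB_kappa, D.symm.isLUB_kappa, D.isQSubordinate_left,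
    D.symm.isQSubordinate_left, fun hη hν => ?_, fun hr => ?_⟩
  · have h := D.eq_of_isQPure hpure h₁ h₂
    exact ⟨h, D.hasRangeRank_one_of_eq h₂ h⟩
  · exact ⟨D.not_isQSubordinate_left fun h => hη (by rw [h, QWeight.rankOneMap_zero]),
      D.symm.not_isQSubordinate_left fun h => hν (by rw [h, QWeight.rankOneMap_zero])⟩
  · exact ⟨D.not_isQSubordinate_left (D.sub_kappa_ne_zero_of_hasRangeRank_two hr),
      D.symm.not_isQSubordinate_left (D.symm.sub_kappa_ne_zero_of_hasRangeRank_two hr)⟩
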